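/- **Setting.** Let $Z\in\mathbb R^K$, $E\in\mathbb R^p$, $\varepsilon\in\mathbb R$ be mutually independent, mean-zero, square-integrable random variables with $K\ge 1$, and put $\Sigma_Z=\mathrm{Cov}(Z)$, $\Sigma_E=\mathrm{Cov}(E)$, $\sigma_\varepsilon^2=\mathrm{Var}(\varepsilon)$. For $A\in\mathbb R^{p\times K}$ and $\beta\in\mathbb R^K$ let $X_i=AZ_i+E_i$, $y_i=Z_i^\top\beta+\varepsilon_i$ $(1\le i\le n)$, where $(Z_i,E_i,\varepsilon_i)$ are i.i.d. copies of $(Z,E,\varepsilon)$. Let $\mathbf X\in\mathbb R^{n\times p}$ have rows $X_i$, let $\mathbf y=(y_1,\dots,y_n)^\top$, and let $$\widehat\alpha=\arg\min\{\|\alpha\| : \|\mathbf X\alpha-\mathbf y\|=\min_u\|\mathbf Xu-\mathbf y\|\}$$ be the minimum-norm estimator. Write $\|\beta\|_{\Sigma_Z}^2=\beta^\top\Sigma_Z\beta$, let $\lambda_K(Q)$ be the $K$-th largest eigenvalue of a symmetric matrix $Q$, and let $\mathrm r_e(\Sigma_E)=\mathrm{tr}(\Sigma_E)/\|\Sigma_E\|$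 be the effective rank, with operator norm $\|\Sigma_E\|$ (and $\mathrm r_e(0)=1$). Let $M\ge 0$, and for a real random variable $U$ let $\|U\|_{\psi_2}=\inf\{t>0:\mathbb E\exp(U^2/t^2)\le 2\}$. For a constant $C>0$, consider the conditions: * $A$ and $\Sigma_Z$ have rank $K$; * $E=\Sigma_E^{1/2}\tilde E$, where $\tilde E$ has independent entries with mean zero, unit variance and $\psi_2$-norm at most $M$; $Z=\Sigma_Z^{1/2}\tilde Z$ and $\varepsilon=\sigma_\varepsilon\tilde\varepsilon$, where $\tilde Z$ and $\tilde\varepsilon$ have mean zero, and the entries of $\tilde Z$, and $\tilde\varepsilon$, have $\psi_2$-norm at most $M$; * $n>C\,K$ and $\mathrm r_e(\Sigma_E)>C\,n$. **Statement.** There are constants $C,c>0$ depending only on $M$ such that the following hold. 1. There is a constant $C'>0$ depending only on $M$ such that, whenever the conditions hold, with probability exceeding $1-c/n$, $$\|\widehat\alpha\|^2\le C'\left(\frac{\|\beta\|^2_{\Sigma_Z}}{\lambda_K(A\Sigma_ZA^\top)}+\sigma_\varepsilon^2\,\frac{n\log n}{\mathrm{tr}(\Sigma_E)}\right),\qquad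 \mathrm{tr}(\Sigma_E)=\|\Sigma_E\|\,\mathrm r_e(\Sigma_E).$$ 2. For every $\kappa>0$ there is a constant $C'>0$ depending only on $M$ and $\kappa$ such that, whenever the conditions hold and $\|\Sigma_E\|\ge\kappa$, with probability exceeding $1-c/n$, $$\|\widehat\alpha\|^2\le C'\left(\frac{\|\beta\|^2_{\Sigma_Z}}{\lambda_K(A\Sigma_ZA^\top)}+\sigma_\varepsilon^2\,\frac{n\log n}{\mathrm r_e(\Sigma_E)}\right).$$ 3. Consequently, along any sequence of such models, with varying $n,p,K$ and all satisfying the conditions with these $M$ and $C$, for which $n\to\infty$, $\|\beta\|^2_{\Sigma_Z}/\lambda_K(A\Sigma_ZA^\top)\to0$ and $\sigma_\varepsilon^2\,n\log n/\mathrm{tr}(\Sigma_E)\to0$, one has $\|\widehat\alpha\|\to0$ in probability. -/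

import Mathlib

open MeasureTheory ProbabilityTheory Filter Topology
open scoped NNReal ENNReal MatrixOrder

universe u v

noncomputable section

/-! ### Minimum-norm least squares -/

/-- `a` minimises `u ↦ ‖X u - y‖` (Euclidean norm). -/
def IsLeastSquares {n p : ℕ} (X : Matrix (Fin n) (Fin p) ℝ) (y : EuclideanSpace ℝ (Fin n))
    (a : EuclideanSpace ℝ (Fin p)) : Prop :=
  ∀ u : EuclideanSpace ℝ (Fin p),
    ‖Matrix.toEuclideanLin X a - y‖ ≤ ‖Matrix.toEuclideanLin X u - y‖

/-- `a` has the smallest Euclidean norm among the minimisers of `u ↦ ‖X u - y‖`. -/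
def IsMinNormLeastSquares {n p : ℕ} (X : Matrix (Fin n) (Fin p) ℝ)
    (y : EuclideanSpace ℝ (Fin n)) (a : EuclideanSpace ℝ (Fin p)) : Prop :=
  IsLeastSquares X y a ∧ ∀ b, IsLeastSquares X y b → ‖a‖ ≤ ‖b‖

/-- The minimum-norm least-squares solution exists and is unique. -/
theorem existsUnique_isMinNormLeastSquares {n p : ℕ} (X : Matrix (Fin n) (Fin p) ℝ)
    (y : EuclideanSpace ℝ (Fin n)) : ∃! a, IsMinNormLeastSquares X y a := by
  set T := Matrix.toEuclideanLin X with hT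
  set R := LinearMap.range T with hR
  set N := LinearMap.ker T with hN
  have hpy : ∀ w : EuclideanSpace ℝ (Fin p),
      ‖T w - y‖ ^ 2 = ‖T w - R.starProjection y‖ ^ 2 + ‖R.starProjection y - y‖ ^ 2 := by
    intro w
    have h1 : T w - y = (T w - R.starProjection y) + (R.starProjection y - y) := by abel
    have h2 : inner ℝ (T w - R.starProjection y) (R.starProjection y - y) = (0 : ℝ) := by
      have h3 : T w - R.starProjection y ∈ R :=
        R.sub_mem (LinearMap.mem_range_self T w) (R.starProjection_apply_mem y)
      have h4 := R.sub_starProjection_mem_orthogonal y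
      have h5 := (Submodule.mem_orthogonal R _).1 h4 _ h3
      rw [← neg_sub y, inner_neg_right, h5, neg_zero]
    rw [h1, norm_add_sq_real, h2]
    ring
  obtain ⟨a0, ha0⟩ : ∃ a0, T a0 = R.starProjection y := R.starProjection_apply_mem y
  have hls : ∀ w, IsLeastSquares X y w ↔ T w = R.starProjection y := by
    intro w
    constructor
    · intro h
      have h1 := h a0
      rw [← hT] at h1
      have h2 := pow_le_pow_left₀ (norm_nonneg _) h1 2
      rw [hpy, hpy, ha0, sub_self, norm_zero] at h2
      have h3 : ‖T w - R.starProjection y‖ ^ 2 = 0 :=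
        le_antisymm (by linarith) (sq_nonneg _)
      exact sub_eq_zero.1 (norm_eq_zero.1 (pow_eq_zero_iff two_ne_zero |>.1 h3))
    · intro h u
      rw [← hT]
      refine (sq_le_sq₀ (norm_nonneg _) (norm_nonneg _)).1 ?_
      rw [hpy, hpy u, h, sub_self, norm_zero]
      have := sq_nonneg ‖T u - R.starProjection y‖
      linarith
  set a := a0 - N.starProjection a0 with ha
  have haN : a ∈ Nᗮ := N.sub_starProjection_mem_orthogonal a0
  have hTa : T a = R.starProjection y := by
    have : T (N.starProjection a0) = 0 := N.starProjection_apply_mem a0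
    rw [ha, map_sub, this, sub_zero, ha0]
  have hnorm : ∀ b, IsLeastSquares X y b → ‖b‖ ^ 2 = ‖a‖ ^ 2 + ‖b - a‖ ^ 2 := by
    intro b hb
    have h1 : b - a ∈ N := by
      rw [hN, LinearMap.mem_ker, map_sub, (hls b).1 hb, hTa, sub_self]
    have h2 := (Submodule.mem_orthogonal' N _).1 haN _ h1
    have h3 : b = a + (b - a) := by abel
    conv_lhs => rw [h3]
    rw [norm_add_sq_real, h2]
    ring
  refine ⟨a, ⟨(hls a).2 hTa, fun b hb => ?_⟩, fun b hb => ?_⟩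
  · refine (sq_le_sq₀ (norm_nonneg _) (norm_nonneg _)).1 ?_
    have := hnorm b hb
    have := sq_nonneg ‖b - a‖
    linarith
  · have h1 := hb.2 a ((hls a).2 hTa)
    have h2 := pow_le_pow_left₀ (norm_nonneg _) h1 2
    have h3 := hnorm b hb.1
    have h4 : ‖b - a‖ ^ 2 = 0 := le_antisymm (by linarith) (sq_nonneg _)
    exact sub_eq_zero.1 (norm_eq_zero.1 (pow_eq_zero_iff two_ne_zero |>.1 h4))

/-- `argmin {‖α‖ : ‖X α - y‖ = min_u ‖X u - y‖}`. -/
def minNormLeastSquares {n p : ℕ} (X : Matrix (Fin n) (Fin p) ℝ)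
    (y : EuclideanSpace ℝ (Fin n)) : EuclideanSpace ℝ (Fin p) :=
  Classical.choose (existsUnique_isMinNormLeastSquares X y).exists

theorem isMinNormLeastSquares_minNormLeastSquares {n p : ℕ} (X : Matrix (Fin n) (Fin p) ℝ)
    (y : EuclideanSpace ℝ (Fin n)) : IsMinNormLeastSquares X y (minNormLeastSquares X y) :=
  Classical.choose_spec (existsUnique_isMinNormLeastSquares X y).exists

/-! ### Matrix quantities -/

/-- Euclidean operator norm of a square real matrix. -/
def matrixOpNorm {d : ℕ} (Q : Matrix (Fin d) (Fin d) ℝ) : ℝ :=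
  ‖Matrix.toEuclideanCLM (𝕜 := ℝ) Q‖

open Classical in
/-- Effective rank `tr Q / ‖Q‖`, with the convention that it is `1` for `Q = 0`. -/
def effectiveRank {d : ℕ} (Q : Matrix (Fin d) (Fin d) ℝ) : ℝ :=
  if Q = 0 then 1 else Q.trace / matrixOpNorm Q

open Classical in
/-- The `k`-th largest eigenvalue `λ_k(Q)` (`1 ≤ k ≤ d`, counted with multiplicity) of a real
symmetric `d × d` matrix; the value `0` is used for all other arguments. -/
def orderedEigenvalue {d : ℕ} (Q : Matrix (Fin d) (Fin d) ℝ) (k : ℕ) : ℝ :=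
  if h : Q.IsHermitian ∧ 1 ≤ k ∧ k ≤ d then
    h.1.eigenvalues₀ ⟨k - 1, by rw [Fintype.card_fin]; omega⟩
  else 0

/-! ### Probabilistic quantities -/

/-- Covariance matrix of a random vector. -/
def covarianceMatrix {Ω : Type*} [MeasurableSpace Ω] (P : Measure Ω) {d : ℕ}
    (V : Ω → Fin d → ℝ) : Matrix (Fin d) (Fin d) ℝ :=
  Matrix.of fun j k => cov[fun ω => V ω j, fun ω => V ω k; P]

/-- Sub-Gaussian norm `inf {t > 0 : E exp (U² / t²) ≤ 2}`, equal to `∞` if there is no such `t`. -/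
def psiTwoNorm {Ω : Type*} [MeasurableSpace Ω] (P : Measure Ω) (U : Ω → ℝ) : ℝ≥0∞ :=
  ⨅ (t : ℝ≥0) (_ : 0 < t)
    (_ : ∫⁻ ω, ENNReal.ofReal (Real.exp (U ω ^ 2 / (t : ℝ) ^ 2)) ∂P ≤ 2), (t : ℝ≥0∞)

/-! ### Factor regression -/

/-- The factor regression model `X = A Z + E`, `y = Zᵀ β + ε`, together with a sample of size `n`.
The population variables `(Z, E, ε)` live on `(Ω₀, P₀)`; the triples `(Zs i, Es i, εs i)`,
living on `(Ω, P)`, are i.i.d. copies of `(Z, E, ε)`. -/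
structure FactorRegression (n p K : ℕ) where
  Ω₀ : Type u
  [measurableSpace₀ : MeasurableSpace Ω₀]
  P₀ : Measure Ω₀
  [isProbabilityMeasure₀ : IsProbabilityMeasure P₀]
  A : Matrix (Fin p) (Fin K) ℝ
  β : Fin K → ℝ
  Z : Ω₀ → Fin K → ℝ
  E : Ω₀ → Fin p → ℝ
  ε : Ω₀ → ℝ
  measurable_Z : Measurable Z
  measurable_E : Measurable E
  measurable_ε : Measurable ε
  memLp_Z : ∀ k, MemLp (fun ω => Z ω k) 2 P₀
  memLp_E : ∀ j, MemLp (fun ω => E ω j) 2 P₀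
  memLp_ε : MemLp ε 2 P₀
  mean_Z : ∀ k, ∫ ω, Z ω k ∂P₀ = 0
  mean_E : ∀ j, ∫ ω, E ω j ∂P₀ = 0
  mean_ε : ∫ ω, ε ω ∂P₀ = 0
  /- The next two fields say that `Z`, `E`, `ε` are mutually independent. -/
  indep_Z : IndepFun Z (fun ω => (E ω, ε ω)) P₀
  indep_E : IndepFun E ε P₀
  Ω : Type v
  [measurableSpace : MeasurableSpace Ω]
  P : Measure Ω
  [isProbabilityMeasure : IsProbabilityMeasure P]
  Zs : Fin n → Ω → Fin K → ℝ
  Es : Fin n → Ω → Fin p → ℝ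
  εs : Fin n → Ω → ℝ
  iIndep_sample : iIndepFun (fun i ω => (Zs i ω, Es i ω, εs i ω)) P
  identDistrib_sample : ∀ i,
    IdentDistrib (fun ω => (Zs i ω, Es i ω, εs i ω)) (fun ω => (Z ω, E ω, ε ω)) P P₀

namespace FactorRegression

attribute [instance] measurableSpace₀ isProbabilityMeasure₀ measurableSpace isProbabilityMeasure

variable {n p K : ℕ} (F : FactorRegression.{u, v} n p K)

/-- `Σ_Z = Cov(Z)`. -/
def covZ : Matrix (Fin K) (Fin K) ℝ := covarianceMatrix F.P₀ F.Z

/-- `Σ_E = Cov(E)`. -/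
def covE : Matrix (Fin p) (Fin p) ℝ := covarianceMatrix F.P₀ F.E

/-- `σ_ε² = Var(ε)`. -/
def varε : ℝ := Var[F.ε; F.P₀]

/-- The data matrix, whose `i`-th row is `X_i = A Z_i + E_i`. -/
def X (ω : F.Ω) : Matrix (Fin n) (Fin p) ℝ :=
  Matrix.of fun i => F.A.mulVec (F.Zs i ω) + F.Es i ω

/-- The response vector, with entries `y_i = Z_iᵀ β + ε_i`. -/
def y (ω : F.Ω) : EuclideanSpace ℝ (Fin n) :=
  WithLp.toLp 2 fun i => F.Zs i ω ⬝ᵥ F.β + F.εs i ω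

/-- The minimum-norm estimator `α̂`. -/
def αHat (ω : F.Ω) : EuclideanSpace ℝ (Fin p) := minNormLeastSquares (F.X ω) (F.y ω)

/-- `‖β‖²_{Σ_Z} = βᵀ Σ_Z β`. -/
def signal : ℝ := F.β ⬝ᵥ F.covZ.mulVec F.β

/-- `λ_K(A Σ_Z Aᵀ)`. -/
def signalEigenvalue : ℝ := orderedEigenvalue (F.A * F.covZ * F.A.transpose) K

/-- `A` and `Σ_Z` have full rank `K`. -/
def FullRank : Prop := F.A.rank = K ∧ F.covZ.rank = K

/-- `E = Σ_E^{1/2} Ẽ`, where `Ẽ` has independent, centred entries with unit variance;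
`Z = Σ_Z^{1/2} Z̃` and `ε = σ_ε ε̃` with `Z̃`, `ε̃` centred; the entries of `Ẽ`, those of `Z̃`, and
`ε̃` have sub-Gaussian norm at most `M`. -/
def SubGaussian (M : ℝ≥0) : Prop :=
  (∃ Et : F.Ω₀ → Fin p → ℝ, Measurable Et ∧
    (∀ᵐ ω ∂F.P₀, F.E ω = (CFC.sqrt F.covE).mulVec (Et ω)) ∧
    iIndepFun (fun j ω => Et ω j) F.P₀ ∧
    ∀ j, ∫ ω, Et ω j ∂F.P₀ = 0 ∧ Var[fun ω => Et ω j; F.P₀] = 1 ∧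
      psiTwoNorm F.P₀ (fun ω => Et ω j) ≤ M) ∧
  (∃ Zt : F.Ω₀ → Fin K → ℝ, Measurable Zt ∧
    (∀ᵐ ω ∂F.P₀, F.Z ω = (CFC.sqrt F.covZ).mulVec (Zt ω)) ∧
    ∀ k, ∫ ω, Zt ω k ∂F.P₀ = 0 ∧ psiTwoNorm F.P₀ (fun ω => Zt ω k) ≤ M) ∧
  (∃ εt : F.Ω₀ → ℝ, Measurable εt ∧
    (∀ᵐ ω ∂F.P₀, F.ε ω = Real.sqrt F.varε * εt ω) ∧
    ∫ ω, εt ω ∂F.P₀ = 0 ∧ psiTwoNorm F.P₀ εt ≤ M)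

/-- All conditions on the model, for a sub-Gaussian bound `M` and a constant `C`. -/
structure Conditions (M : ℝ≥0) (C : ℝ) : Prop where
  one_le_K : 1 ≤ K
  fullRank : F.FullRank
  subGaussian : F.SubGaussian M
  n_large : C * K < n
  effectiveRank_large : C * n < effectiveRank F.covE

end FactorRegression

end

/-! The vector a = A(AᵀA)⁻¹β satisfies Aᵀa = β and lies in the range of AΣ_ZAᵀ, where this matrix is
at least λ_K; hence λ_K‖a‖² ≤ aᵀAΣ_ZAᵀa = βᵀΣ_Zβ (`exists_transpose_mulVec_eq`). Since y - Xa = ε -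
Ea, with E the matrix of noise rows, only noise is left to fit. If s‖u‖ ≤ ‖Xᵀu‖ for all u, then X is
onto, a correction of norm at most ‖ε - Ea‖ / s makes the fit exact, and ‖α̂‖ ≤ ‖a‖ + ‖ε - Ea‖ / s
(`norm_minNormLeastSquares_le`).

Put τ = tr Σ_E and g = ‖Σ_E‖. Both s and the operator norm of E have order √τ, so Ea contributes a
multiple of ‖a‖, and ε contributes ‖ε‖² / τ, where ‖ε‖² is at most of order n σ_ε² log n by a union
bound. For s, projecting off the range of A annihilates the factor part of Xᵀu and leaves a
projection of Eᵀu; this costs at most Kg ≤ τ/2 of the trace. For a fixed unit vector u, ‖Eᵀu‖² and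
its projected version are quadratic forms in np independent variables, with trace between τ/2 and τ
and norm at most g. They keep the order of their trace up to probability exp(-cτ/g). As τ/g =
r_e(Σ_E) exceeds a large multiple of n, this survives a union over a net of the sphere of ℝⁿ
(`measure_not_isWellSpread_le`).

The exponential moments of such a form Q are bounded by integrating out one coordinate at a time. A
single variable turns a x² + 2bx into a multiple of a plus L b², where b is linear in the other
coordinates; L b² is absorbed into the remaining form as a rank-one update. For L g ≤ 1 the update
keeps the form between 0 and g, so the induction closes (`lintegral_exp_neg_quadForm_le`,
`lintegral_exp_quadForm_le`). -/

/-! ### Exponential moments of one sub-Gaussian variable. -/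

theorem Real.exp_le_add_exp_sq (x : ℝ) : Real.exp x ≤ x + Real.exp (x ^ 2) := by
  have h2 := Real.add_one_le_exp (x ^ 2)
  rcases le_total |x| 1 with h | h
  · have h1 := (abs_le.1 (Real.abs_exp_sub_one_sub_id_le h)).2
    linarith
  · rcases le_abs'.1 h with h | h
    · have h1 : Real.exp x ≤ 1 := Real.exp_le_one_iff.2 (by linarith)
      nlinarith
    · have h1 : Real.exp x ≤ Real.exp (x ^ 2) := Real.exp_le_exp.2 (by nlinarith)
      linarith

theorem Real.exp_mul_le_one_add_mul {s : ℝ} (hs : 0 ≤ s) (hs' : s ≤ 1) (y : ℝ) :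
    Real.exp (s * y) ≤ 1 + s * (Real.exp y - 1) := by
  have h := convexOn_exp.2 (Set.mem_univ (0 : ℝ)) (Set.mem_univ y) (sub_nonneg.2 hs') hs (by ring)
  simp only [smul_eq_mul, mul_zero, zero_add, Real.exp_zero] at h
  linarith

theorem Real.exp_add_le_half_add (s t : ℝ) :
    Real.exp (s + t) ≤ (Real.exp (2 * s) + Real.exp (2 * t)) / 2 := by
  have h1 : Real.exp (2 * s) = Real.exp s ^ 2 := by rw [two_mul, Real.exp_add, sq]
  have h2 : Real.exp (2 * t) = Real.exp t ^ 2 := by rw [two_mul, Real.exp_add, sq]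
  rw [h1, h2, Real.exp_add]
  nlinarith [sq_nonneg (Real.exp s - Real.exp t)]

/-- A standardised law on the line whose square has a controlled exponential moment. -/
structure IsStdSubGaussian (μ : Measure ℝ) (m : ℝ) : Prop where
  one_le : 1 ≤ m
  integrable_exp : Integrable (fun x : ℝ => Real.exp (x ^ 2 / m ^ 2)) μ
  integral_exp_le : ∫ x, Real.exp (x ^ 2 / m ^ 2) ∂μ ≤ 2
  integral_id : ∫ x, x ∂μ = 0
  integral_sq : ∫ x, x ^ 2 ∂μ = 1

namespace IsStdSubGaussian

variable {μ : Measure ℝ} {m : ℝ}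

theorem integrable_of_le (h : IsStdSubGaussian μ m) {f : ℝ → ℝ} (hf : Continuous f) (c : ℝ)
    (hfc : ∀ x, |f x| ≤ c * Real.exp (x ^ 2 / m ^ 2)) : Integrable f μ :=
  (h.integrable_exp.const_mul c).mono' hf.aestronglyMeasurable (ae_of_all _ hfc)

theorem integrable_sq (h : IsStdSubGaussian μ m) : Integrable (fun x : ℝ => x ^ 2) μ := by
  have hm := h.one_le
  refine h.integrable_of_le (by fun_prop) (m ^ 2) fun x => ?_
  rw [abs_of_nonneg (sq_nonneg x)]
  have h1 := Real.add_one_le_exp (x ^ 2 / m ^ 2)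
  have h2 : x ^ 2 = m ^ 2 * (x ^ 2 / m ^ 2) := by field_simp
  have h3 : 0 < m ^ 2 := by positivity
  nlinarith

theorem pow_four_le (hm : 1 ≤ m) (x : ℝ) :
    x ^ 4 ≤ 2 * m ^ 4 * Real.exp (x ^ 2 / m ^ 2) := by
  have h1 := Real.quadratic_le_exp_of_nonneg (x := x ^ 2 / m ^ 2) (by positivity)
  have h2 : x ^ 4 = m ^ 4 * (x ^ 2 / m ^ 2) ^ 2 := by field_simp
  have h3 : 0 < m ^ 4 := by positivity
  have h4 : 0 ≤ x ^ 2 / m ^ 2 := by positivity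
  nlinarith

theorem integrable_pow_four (h : IsStdSubGaussian μ m) : Integrable (fun x : ℝ => x ^ 4) μ := by
  refine h.integrable_of_le (by fun_prop) (2 * m ^ 4) fun x => ?_
  rw [abs_of_nonneg (by positivity)]
  exact pow_four_le h.one_le x

theorem integral_pow_four_le (h : IsStdSubGaussian μ m) : ∫ x, x ^ 4 ∂μ ≤ 4 * m ^ 4 := by
  have h1 := integral_mono h.integrable_pow_four (h.integrable_exp.const_mul (2 * m ^ 4))
    (pow_four_le h.one_le)
  rw [integral_const_mul] at h1
  have h2 := h.integral_exp_le
  have : 0 ≤ m ^ 4 := by positivity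
  nlinarith

theorem integrable_id [IsProbabilityMeasure μ] (h : IsStdSubGaussian μ m) : Integrable (fun x : ℝ => x) μ := by
  refine ((integrable_const (1 : ℝ)).add h.integrable_sq).mono' (by fun_prop)
    (ae_of_all _ fun x => ?_)
  simp only [Pi.add_apply, Real.norm_eq_abs]
  rw [← sq_abs]
  nlinarith [sq_nonneg (|x| - 1), abs_nonneg x]

theorem integrable_exp_sq (h : IsStdSubGaussian μ m) {a : ℝ} (ha' : a * m ^ 2 ≤ 1) :
    Integrable (fun x : ℝ => Real.exp (a * x ^ 2)) μ := by
  have hm := h.one_le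
  refine h.integrable_of_le (by fun_prop) 1 fun x => ?_
  rw [abs_of_pos (Real.exp_pos _), one_mul, Real.exp_le_exp, le_div_iff₀ (by positivity)]
  nlinarith [sq_nonneg x]

/-- Convexity: with s = a m² ≤ 1, exp(s y) lies below the chord 1 + s(exp y - 1), whose mean at y =
x²/m² is at most 1 + s. -/
theorem integral_exp_sq_le [IsProbabilityMeasure μ] (h : IsStdSubGaussian μ m) {a : ℝ} (ha : 0 ≤ a) (ha' : a * m ^ 2 ≤ 1) :
    ∫ x, Real.exp (a * x ^ 2) ∂μ ≤ Real.exp (a * m ^ 2) := by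
  have hm := h.one_le
  have h1 : ∀ x : ℝ, Real.exp (a * x ^ 2) ≤
      (1 - a * m ^ 2) + a * m ^ 2 * Real.exp (x ^ 2 / m ^ 2) := fun x => by
    have := Real.exp_mul_le_one_add_mul (s := a * m ^ 2) (by positivity) ha' (x ^ 2 / m ^ 2)
    have h2 : a * m ^ 2 * (x ^ 2 / m ^ 2) = a * x ^ 2 := by field_simp
    rw [h2] at this
    linarith
  have h2 := integral_mono (h.integrable_exp_sq ha')
    ((integrable_const _).add (h.integrable_exp.const_mul (a * m ^ 2))) h1
  rw [integral_add' (integrable_const _) (h.integrable_exp.const_mul _), integral_const_mul] at h2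
  simp only [integral_const, probReal_univ, smul_eq_mul, one_mul] at h2
  have h3 := Real.add_one_le_exp (a * m ^ 2)
  have h4 := h.integral_exp_le
  have h5 : 0 ≤ a * m ^ 2 := by positivity
  nlinarith

theorem integrable_exp_mul (h : IsStdSubGaussian μ m) (t : ℝ) :
    Integrable (fun x : ℝ => Real.exp (t * x)) μ := by
  have hm := h.one_le
  refine h.integrable_of_le (by fun_prop) (Real.exp (t ^ 2 * m ^ 2)) fun x => ?_
  rw [abs_of_pos (Real.exp_pos _), ← Real.exp_add, Real.exp_le_exp]
  have h2 : t * x = (t * m) * (x / m) := by field_simp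
  rw [h2, ← mul_pow, ← div_pow]
  nlinarith [sq_nonneg (t * m - x / m), sq_nonneg (t * m), sq_nonneg (x / m)]

/-- For t²m² ≤ 1, the inequality exp z ≤ z + exp(z²) and the zero mean leave only the square. For
t²m² ≥ 1, t x ≤ t²m²/2 + x²/(2m²) suffices, the extra factor exp(1/2) being absorbed by exp(t²m²/2).
-/
theorem integral_exp_mul_le [IsProbabilityMeasure μ] (h : IsStdSubGaussian μ m) (t : ℝ) :
    ∫ x, Real.exp (t * x) ∂μ ≤ Real.exp (t ^ 2 * m ^ 2) := by
  have hm := h.one_le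
  rcases le_total (t ^ 2 * m ^ 2) 1 with ht | ht
  · have hi := h.integrable_id.const_mul t
    have h1 := integral_mono (h.integrable_exp_mul t) (hi.add (h.integrable_exp_sq ht))
      (fun x => by
        have := Real.exp_le_add_exp_sq (t * x)
        rw [mul_pow] at this
        exact this)
    rw [integral_add' hi (h.integrable_exp_sq ht), integral_const_mul, h.integral_id, mul_zero,
      zero_add] at h1
    exact h1.trans (h.integral_exp_sq_le (sq_nonneg t) ht)
  · have hs : (1 / (2 * m ^ 2)) * m ^ 2 = 1 / 2 := by field_simp
    have hi := h.integrable_exp_sq (a := 1 / (2 * m ^ 2)) (by rw [hs]; norm_num)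
    have h1 := integral_mono (h.integrable_exp_mul t)
      (hi.const_mul (Real.exp (t ^ 2 * m ^ 2 / 2)))
      (fun x => by
        show Real.exp (t * x) ≤ Real.exp (t ^ 2 * m ^ 2 / 2) * Real.exp (1 / (2 * m ^ 2) * x ^ 2)
        rw [← Real.exp_add, Real.exp_le_exp]
        have h2 : t * x = (t * m) * (x / m) := by field_simp
        have h3 : 1 / (2 * m ^ 2) * x ^ 2 = (x / m) ^ 2 / 2 := by field_simp
        rw [h2, h3, ← mul_pow]
        nlinarith [sq_nonneg (t * m - x / m)])
    rw [integral_const_mul] at h1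
    refine h1.trans ?_
    have h2 := h.integral_exp_sq_le (a := 1 / (2 * m ^ 2)) (by positivity) (by rw [hs]; norm_num)
    rw [hs] at h2
    calc _ ≤ Real.exp (t ^ 2 * m ^ 2 / 2) * Real.exp (1 / 2) := by gcongr
      _ ≤ _ := by
        rw [← Real.exp_add, Real.exp_le_exp]
        linarith

theorem integrable_exp_neg_sq (h : IsStdSubGaussian μ m) {a : ℝ} (ha : 0 ≤ a) :
    Integrable (fun x : ℝ => Real.exp (-(2 * a * x ^ 2))) μ := by
  simp_rw [← neg_mul]
  exact h.integrable_exp_sq (by nlinarith [sq_nonneg m])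

/-- Since exp(-y) ≤ 1 - y + y²/2 for y ≥ 0, unit variance gives the term -2a, and the fourth moment
costs at most 8a²m⁴ ≤ a/2. -/
theorem integral_exp_neg_sq_le [IsProbabilityMeasure μ] (h : IsStdSubGaussian μ m) {a : ℝ} (ha : 0 ≤ a)
    (ha' : a * (16 * m ^ 4) ≤ 1) :
    ∫ x, Real.exp (-(2 * a * x ^ 2)) ∂μ ≤ Real.exp (-a) := by
  have hi := (((integrable_const (1 : ℝ)).sub (h.integrable_sq.const_mul (2 * a))).add
    (h.integrable_pow_four.const_mul (2 * a ^ 2)))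
  have h1 := integral_mono (h.integrable_exp_neg_sq ha) hi (fun x => by
    show Real.exp (-(2 * a * x ^ 2)) ≤ 1 - 2 * a * x ^ 2 + 2 * a ^ 2 * x ^ 4
    have hy : 0 ≤ 2 * a * x ^ 2 := by positivity
    have h2 := Real.quadratic_le_exp_of_nonneg hy
    have h3 : Real.exp (-(2 * a * x ^ 2)) * Real.exp (2 * a * x ^ 2) = 1 := by
      rw [← Real.exp_add, neg_add_cancel, Real.exp_zero]
    have h4 : 2 * a ^ 2 * x ^ 4 = (2 * a * x ^ 2) ^ 2 / 2 := by ring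
    rw [h4]
    generalize 2 * a * x ^ 2 = y at *
    have h5 := Real.exp_pos (-y)
    by_contra hcon
    push Not at hcon
    nlinarith [mul_nonneg hy hy, mul_nonneg (mul_nonneg hy hy) (mul_nonneg hy hy),
      sq_nonneg (y - 1)])
  rw [integral_add' ((integrable_const _).sub (h.integrable_sq.const_mul _))
    (h.integrable_pow_four.const_mul _), integral_sub' (integrable_const _)
    (h.integrable_sq.const_mul _), integral_const_mul, integral_const_mul, h.integral_sq] at h1
  simp only [integral_const, probReal_univ, smul_eq_mul, one_mul] at h1
  have h2 := h.integral_pow_four_le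
  have h3 := Real.add_one_le_exp (-a)
  have h4 : 2 * a ^ 2 * ∫ x, x ^ 4 ∂μ ≤ 2 * a ^ 2 * (4 * m ^ 4) := by gcongr
  have h5 : 2 * a ^ 2 * (4 * m ^ 4) = a * (a * (16 * m ^ 4)) / 2 := by ring
  nlinarith

/-- Cauchy–Schwarz, obtained pointwise from the weighted arithmetic-geometric mean inequality; the
weights exp(±(β - α)) make both terms equal to exp(α + β). -/
theorem lintegral_exp_add_le {f g : ℝ → ℝ} {α β : ℝ} (hf : Integrable (fun x => Real.exp (2 * f x)) μ)
    (hg : Integrable (fun x => Real.exp (2 * g x)) μ)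
    (hf' : ∫ x, Real.exp (2 * f x) ∂μ ≤ Real.exp (2 * α))
    (hg' : ∫ x, Real.exp (2 * g x) ∂μ ≤ Real.exp (2 * β)) :
    ∫⁻ x, ENNReal.ofReal (Real.exp (f x + g x)) ∂μ ≤ ENNReal.ofReal (Real.exp (α + β)) := by
  set r := (β - α) with hr
  have hI := ((hf.const_mul (Real.exp r)).add (hg.const_mul (Real.exp (-r)))).div_const 2
  calc _ ≤ ∫⁻ x, ENNReal.ofReal ((Real.exp r * Real.exp (2 * f x)
          + Real.exp (-r) * Real.exp (2 * g x)) / 2) ∂μ := by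
        refine lintegral_mono fun x => ENNReal.ofReal_le_ofReal ?_
        have := Real.exp_add_le_half_add (f x + r / 2) (g x - r / 2)
        rw [← Real.exp_add, ← Real.exp_add]
        convert this using 1
        · congr 1; ring
        · congr 3 <;> ring
    _ = ENNReal.ofReal (∫ x, (Real.exp r * Real.exp (2 * f x)
          + Real.exp (-r) * Real.exp (2 * g x)) / 2 ∂μ) :=
        (ofReal_integral_eq_lintegral_ofReal hI (ae_of_all _ fun x => by
          simp only [Pi.zero_apply, Pi.add_apply]; positivity)).symm
    _ ≤ _ := by
        refine ENNReal.ofReal_le_ofReal ?_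
        rw [integral_div, integral_add (hf.const_mul _) (hg.const_mul _), integral_const_mul,
          integral_const_mul]
        have h1 : Real.exp r * Real.exp (2 * α) = Real.exp (α + β) := by
          rw [← Real.exp_add]; congr 1; rw [hr]; ring
        have h2 : Real.exp (-r) * Real.exp (2 * β) = Real.exp (α + β) := by
          rw [← Real.exp_add]; congr 1; rw [hr]; ring
        have h3 := mul_le_mul_of_nonneg_left hf' (Real.exp_pos r).le
        have h4 := mul_le_mul_of_nonneg_left hg' (Real.exp_pos (-r)).le
        linarith

theorem lintegral_exp_neg_quadratic_le [IsProbabilityMeasure μ] (h : IsStdSubGaussian μ m) {a : ℝ} (ha : 0 ≤ a)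
    (ha' : a * (16 * m ^ 4) ≤ 1) (b : ℝ) :
    ∫⁻ x, ENNReal.ofReal (Real.exp (-(a * x ^ 2 + 2 * b * x))) ∂μ
      ≤ ENNReal.ofReal (Real.exp (-(a / 2) + 8 * m ^ 2 * b ^ 2)) := by
  have h1 := lintegral_exp_add_le (μ := μ) (f := fun x => -(a * x ^ 2)) (g := fun x => -2 * b * x)
    (α := -(a / 2)) (β := 8 * m ^ 2 * b ^ 2)
    (by convert h.integrable_exp_neg_sq ha using 3; ring)
    (by convert h.integrable_exp_mul (-4 * b) using 3; ring)
    (by convert h.integral_exp_neg_sq_le ha ha' using 1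
        · congr 1; ext x; congr 1; ring
        · congr 1; ring)
    (by convert h.integral_exp_mul_le (-4 * b) using 1
        · congr 1; ext x; congr 1; ring
        · congr 1; ring)
  convert h1 using 5
  ring

theorem lintegral_exp_quadratic_le [IsProbabilityMeasure μ] (h : IsStdSubGaussian μ m) {a : ℝ} (ha : 0 ≤ a)
    (ha' : a * (16 * m ^ 4) ≤ 1) (b : ℝ) :
    ∫⁻ x, ENNReal.ofReal (Real.exp (a * x ^ 2 + 2 * b * x)) ∂μ
      ≤ ENNReal.ofReal (Real.exp (m ^ 2 * a + 8 * m ^ 2 * b ^ 2)) := by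
  have hm := h.one_le
  have h0 : 2 * a * m ^ 2 ≤ 1 := by
    have : m ^ 2 ≤ m ^ 4 := pow_le_pow_right₀ hm (by norm_num)
    nlinarith
  exact lintegral_exp_add_le (μ := μ) (f := fun x => a * x ^ 2) (g := fun x => 2 * b * x)
    (by convert h.integrable_exp_sq h0 using 3; ring)
    (by convert h.integrable_exp_mul (4 * b) using 3; ring)
    (by convert h.integral_exp_sq_le (by positivity) h0 using 1
        · congr 1; ext x; congr 1; ring
        · congr 1; ring)
    (by convert h.integral_exp_mul_le (4 * b) using 1
        · congr 1; ext x; congr 1; ring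
        · congr 1; ring)

end IsStdSubGaussian

/-! ### Quadratic forms and elimination of a coordinate. -/

/-- The quadratic form `x ↦ xᵀ Q x`. -/
def Matrix.quadForm {ι : Type*} [Fintype ι] (Q : Matrix ι ι ℝ) (x : ι → ℝ) : ℝ :=
  ∑ i, ∑ j, Q i j * (x i * x j)

/-- `Q` is symmetric and `0 ≤ xᵀ Q x ≤ g |x|²` for all `x`. -/
structure Matrix.IsFormBetween {ι : Type*} [Fintype ι] (Q : Matrix ι ι ℝ) (g : ℝ) : Prop where
  symm : ∀ i j, Q i j = Q j i
  nonneg : ∀ x, 0 ≤ Q.quadForm x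
  le : ∀ x, Q.quadForm x ≤ g * ∑ i, x i ^ 2

/-- The form that remains after eliminating the first coordinate. -/
def Matrix.eliminate {N : ℕ} (Q : Matrix (Fin (N + 1)) (Fin (N + 1)) ℝ) (t : ℝ) :
    Matrix (Fin N) (Fin N) ℝ :=
  Matrix.of fun i j => Q i.succ j.succ + t * (Q 0 i.succ * Q 0 j.succ)

namespace Matrix

theorem measurable_quadForm {ι : Type*} [Fintype ι] (Q : Matrix ι ι ℝ) :
    Measurable Q.quadForm := by
  unfold quadForm; fun_prop

theorem quadForm_cons {N : ℕ} {Q : Matrix (Fin (N + 1)) (Fin (N + 1)) ℝ}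
    (hQ : ∀ i j, Q i j = Q j i) (t x₀ : ℝ) (x : Fin N → ℝ) :
    Q.quadForm (Fin.cons x₀ x) = Q 0 0 * x₀ ^ 2 + 2 * (∑ j, Q 0 j.succ * x j) * x₀
      + ((Q.eliminate t).quadForm x - t * (∑ j, Q 0 j.succ * x j) ^ 2) := by
  have h1 : (Q.eliminate t).quadForm x = ∑ i, ∑ j, Q (Fin.succ i) (Fin.succ j) * (x i * x j)
      + t * (∑ j, Q 0 j.succ * x j) ^ 2 := by
    rw [sq, Finset.sum_mul_sum, Finset.mul_sum, ← Finset.sum_add_distrib]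
    refine Finset.sum_congr rfl fun i _ => ?_
    rw [Finset.mul_sum, ← Finset.sum_add_distrib]
    refine Finset.sum_congr rfl fun j _ => ?_
    simp only [eliminate, of_apply]
    ring
  rw [h1]
  simp only [quadForm, Fin.sum_univ_succ, Fin.cons_zero, Fin.cons_succ, Finset.sum_add_distrib]
  have h2 : ∑ i : Fin N, Q i.succ 0 * (x i * x₀) = (∑ j, Q 0 j.succ * x j) * x₀ := by
    rw [Finset.sum_mul]
    exact Finset.sum_congr rfl fun i _ => by rw [hQ i.succ 0]; ring
  have h3 : ∑ i : Fin N, Q 0 i.succ * (x₀ * x i) = (∑ j, Q 0 j.succ * x j) * x₀ := by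
    rw [Finset.sum_mul]
    exact Finset.sum_congr rfl fun i _ => by ring
  rw [h2, h3]
  ring

namespace IsFormBetween

variable {N : ℕ} {Q : Matrix (Fin (N + 1)) (Fin (N + 1)) ℝ} {g : ℝ}

theorem diag_nonneg (h : Q.IsFormBetween g) : 0 ≤ Q 0 0 := by
  have := h.nonneg (Fin.cons 1 0)
  rw [quadForm_cons h.symm 0] at this
  simpa [quadForm] using this

theorem diag_le (h : Q.IsFormBetween g) : Q 0 0 ≤ g := by
  have := h.le (Fin.cons 1 0)
  rw [quadForm_cons h.symm 0] at this
  simpa [quadForm, Fin.sum_univ_succ] using this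

/-- Let q be the rest of the first row. Nonnegativity at (-g, q) reads g² Q₀₀ - 2g|q|² + Q'(q) ≥ 0,
and Q'(q) ≤ g|q|². -/
theorem sum_sq_le (h : Q.IsFormBetween g) (hg : 0 < g) :
    ∑ j : Fin N, Q 0 j.succ ^ 2 ≤ g * Q 0 0 := by
  have h1 := h.nonneg (Fin.cons (-g) fun j => Q 0 j.succ)
  have h2 := h.le (Fin.cons 0 fun j => Q 0 j.succ)
  rw [quadForm_cons h.symm 0] at h1 h2
  have h3 : ∑ j : Fin N, Q 0 j.succ * Q 0 j.succ = ∑ j : Fin N, Q 0 j.succ ^ 2 :=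
    Finset.sum_congr rfl fun j _ => (sq _).symm
  simp only [Fin.sum_univ_succ, Fin.cons_zero, Fin.cons_succ, h3] at h1 h2
  nlinarith

/-- A Schur complement argument: L ≤ 1/g, so less is subtracted than would make the form degenerate.
Completing x by the first coordinate -L s, with s the pairing of x with the first row, certifies
nonnegativity. -/
theorem eliminate_neg (h : Q.IsFormBetween g) {L : ℝ} (hL : 0 ≤ L) (hLg : L * g ≤ 1) :
    (Q.eliminate (-L)).IsFormBetween g where
  symm i j := by simp only [eliminate, of_apply, h.symm i.succ j.succ]; ring
  nonneg x := by
    have h1 := h.nonneg (Fin.cons (-L * ∑ j, Q 0 j.succ * x j) x)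
    rw [quadForm_cons h.symm (-L)] at h1
    have h2 : Q 0 0 * L ≤ 1 := by nlinarith [h.diag_le]
    generalize ∑ j, Q 0 j.succ * x j = s at *
    nlinarith [mul_nonneg (mul_nonneg hL (sub_nonneg.2 h2)) (sq_nonneg s)]
  le x := by
    have h1 := h.le (Fin.cons 0 x)
    rw [quadForm_cons h.symm (-L)] at h1
    simp only [Fin.sum_univ_succ, Fin.cons_zero, Fin.cons_succ] at h1
    nlinarith [mul_nonneg hL (sq_nonneg (∑ j, Q 0 j.succ * x j))]

/-- The same argument for the upper bound g, now with the first coordinate L s. -/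
theorem eliminate_pos (h : Q.IsFormBetween g) {L : ℝ} (hL : 0 ≤ L) (hLg : L * g ≤ 1) :
    (Q.eliminate L).IsFormBetween g where
  symm i j := by simp only [eliminate, of_apply, h.symm i.succ j.succ]; ring
  nonneg x := by
    have h1 := h.nonneg (Fin.cons 0 x)
    rw [quadForm_cons h.symm L] at h1
    nlinarith [mul_nonneg hL (sq_nonneg (∑ j, Q 0 j.succ * x j))]
  le x := by
    have h1 := h.le (Fin.cons (L * ∑ j, Q 0 j.succ * x j) x)
    rw [quadForm_cons h.symm L] at h1
    simp only [Fin.sum_univ_succ, Fin.cons_zero, Fin.cons_succ] at h1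
    have h2 := h.diag_nonneg
    generalize ∑ j, Q 0 j.succ * x j = s at *
    nlinarith [mul_nonneg (mul_nonneg hL (sub_nonneg.2 hLg)) (sq_nonneg s),
      mul_nonneg h2 (sq_nonneg (L * s))]

theorem trace_eliminate (Q : Matrix (Fin (N + 1)) (Fin (N + 1)) ℝ) (t : ℝ) :
    (Q.eliminate t).trace = Q.trace - Q 0 0 + t * ∑ j : Fin N, Q 0 j.succ ^ 2 := by
  simp only [trace, diag_apply, eliminate, of_apply, Fin.sum_univ_succ (n := N),
    Finset.sum_add_distrib, Finset.mul_sum, sq]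
  ring

end IsFormBetween

end Matrix

/-! ### Exponential moments of quadratic forms under product measures. -/

theorem lintegral_pi_fin_succ {N : ℕ} (μ : Fin (N + 1) → Measure ℝ)
    [∀ i, IsProbabilityMeasure (μ i)] {f : (Fin (N + 1) → ℝ) → ℝ≥0∞} (hf : Measurable f) :
    ∫⁻ x, f x ∂Measure.pi μ
      = ∫⁻ x, ∫⁻ x₀, f (Fin.cons x₀ x) ∂(μ 0) ∂(Measure.pi fun i : Fin N => μ i.succ) := by
  have h := (measurePreserving_piFinSuccAbove μ 0).symm
  rw [← h.lintegral_comp hf]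
  simp only [Fin.succAbove_zero]
  rw [lintegral_prod_symm _ (by fun_prop)]
  simp [MeasurableEquiv.piFinSuccAbove, Fin.insertNthEquiv]

/-- The induction loses half of the one-variable gain: the first coordinate yields Q₀₀/2, while the
trace drops by Q₀₀ + L∑q_j² ≤ 2Q₀₀, which at rate 1/4 is paid for exactly. -/
theorem lintegral_exp_neg_quadForm_le {g L : ℝ} (hg : 0 < g) (hL : 0 ≤ L) (hLg : L * g ≤ 1)
    {N : ℕ} (μ : Fin N → Measure ℝ) [∀ i, IsProbabilityMeasure (μ i)]
    (hμ : ∀ i, ∀ a b : ℝ, 0 ≤ a → a ≤ g →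
      ∫⁻ x, ENNReal.ofReal (Real.exp (-(a * x ^ 2 + 2 * b * x))) ∂(μ i)
        ≤ ENNReal.ofReal (Real.exp (-(a / 2) + L * b ^ 2)))
    (Q : Matrix (Fin N) (Fin N) ℝ) (hQ : Q.IsFormBetween g) :
    ∫⁻ x, ENNReal.ofReal (Real.exp (-Q.quadForm x)) ∂(Measure.pi μ)
      ≤ ENNReal.ofReal (Real.exp (-(Q.trace / 4))) := by
  induction N with
  | zero => simp [Matrix.quadForm, Matrix.trace]
  | succ N ih =>
    have hmeas := Q.measurable_quadForm
    rw [lintegral_pi_fin_succ μ (by fun_prop)]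
    have hQ' := hQ.eliminate_neg hL hLg
    calc _ ≤ ∫⁻ x, ENNReal.ofReal (Real.exp (-(Q 0 0 / 2)))
          * ENNReal.ofReal (Real.exp (-(Q.eliminate (-L)).quadForm x))
            ∂(Measure.pi fun i : Fin N => μ i.succ) := by
          refine lintegral_mono fun x => ?_
          set b := ∑ j, Q 0 (Fin.succ j) * x j with hb
          set d := (Q.eliminate (-L)).quadForm x with hd
          calc _ = ∫⁻ x₀, ENNReal.ofReal (Real.exp (-(d + L * b ^ 2)))
                * ENNReal.ofReal (Real.exp (-(Q 0 0 * x₀ ^ 2 + 2 * b * x₀))) ∂(μ 0) := by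
                refine lintegral_congr fun x₀ => ?_
                rw [← ENNReal.ofReal_mul (Real.exp_pos _).le, ← Real.exp_add,
                  Matrix.quadForm_cons hQ.symm (-L)]
                congr 2
                ring
            _ ≤ ENNReal.ofReal (Real.exp (-(d + L * b ^ 2)))
                * ENNReal.ofReal (Real.exp (-(Q 0 0 / 2) + L * b ^ 2)) := by
                rw [lintegral_const_mul _ (by fun_prop)]
                gcongr
                exact hμ 0 _ _ hQ.diag_nonneg hQ.diag_le
            _ = _ := by
                rw [← ENNReal.ofReal_mul (Real.exp_pos _).le,
                  ← ENNReal.ofReal_mul (Real.exp_pos _).le, ← Real.exp_add, ← Real.exp_add]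
                congr 2
                ring
      _ ≤ ENNReal.ofReal (Real.exp (-(Q 0 0 / 2)))
          * ENNReal.ofReal (Real.exp (-((Q.eliminate (-L)).trace / 4))) := by
          have hmeas' := (Q.eliminate (-L)).measurable_quadForm
          rw [lintegral_const_mul _ (by fun_prop)]
          gcongr
          exact ih _ (fun i => hμ i.succ) _ hQ'
      _ ≤ _ := by
          rw [← ENNReal.ofReal_mul (Real.exp_pos _).le, ← Real.exp_add]
          refine ENNReal.ofReal_le_ofReal (Real.exp_le_exp.2 ?_)
          rw [Matrix.IsFormBetween.trace_eliminate]
          have h1 := mul_le_mul_of_nonneg_left (hQ.sum_sq_le hg) hL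
          nlinarith [hQ.diag_nonneg]

/-- Here elimination increases the rest of the trace by L∑q_j² ≤ Q₀₀/2, because L g ≤ 1/2; doubling
κ pays for this. -/
theorem lintegral_exp_quadForm_le {g L κ : ℝ} (hg : 0 < g) (hL : 0 ≤ L) (hLg : L * g ≤ 1 / 2)
    (hκ : 0 ≤ κ) {N : ℕ} (μ : Fin N → Measure ℝ) [∀ i, IsProbabilityMeasure (μ i)]
    (hμ : ∀ i, ∀ a b : ℝ, 0 ≤ a → a ≤ g →
      ∫⁻ x, ENNReal.ofReal (Real.exp (a * x ^ 2 + 2 * b * x)) ∂(μ i)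
        ≤ ENNReal.ofReal (Real.exp (κ * a + L * b ^ 2)))
    (Q : Matrix (Fin N) (Fin N) ℝ) (hQ : Q.IsFormBetween g) :
    ∫⁻ x, ENNReal.ofReal (Real.exp (Q.quadForm x)) ∂(Measure.pi μ)
      ≤ ENNReal.ofReal (Real.exp (2 * κ * Q.trace)) := by
  induction N with
  | zero => simp [Matrix.quadForm, Matrix.trace]
  | succ N ih =>
    have hmeas := Q.measurable_quadForm
    rw [lintegral_pi_fin_succ μ (by fun_prop)]
    have hQ' := hQ.eliminate_pos hL (by linarith)
    calc _ ≤ ∫⁻ x, ENNReal.ofReal (Real.exp (κ * Q 0 0))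
          * ENNReal.ofReal (Real.exp ((Q.eliminate L).quadForm x))
            ∂(Measure.pi fun i : Fin N => μ i.succ) := by
          refine lintegral_mono fun x => ?_
          set b := ∑ j, Q 0 (Fin.succ j) * x j with hb
          set d := (Q.eliminate L).quadForm x with hd
          calc _ = ∫⁻ x₀, ENNReal.ofReal (Real.exp (d - L * b ^ 2))
                * ENNReal.ofReal (Real.exp (Q 0 0 * x₀ ^ 2 + 2 * b * x₀)) ∂(μ 0) := by
                refine lintegral_congr fun x₀ => ?_
                rw [← ENNReal.ofReal_mul (Real.exp_pos _).le, ← Real.exp_add,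
                  Matrix.quadForm_cons hQ.symm L]
                congr 2
                ring
            _ ≤ ENNReal.ofReal (Real.exp (d - L * b ^ 2))
                * ENNReal.ofReal (Real.exp (κ * Q 0 0 + L * b ^ 2)) := by
                rw [lintegral_const_mul _ (by fun_prop)]
                gcongr
                exact hμ 0 _ _ hQ.diag_nonneg hQ.diag_le
            _ = _ := by
                rw [← ENNReal.ofReal_mul (Real.exp_pos _).le,
                  ← ENNReal.ofReal_mul (Real.exp_pos _).le, ← Real.exp_add, ← Real.exp_add]
                congr 2
                ring
      _ ≤ ENNReal.ofReal (Real.exp (κ * Q 0 0))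
          * ENNReal.ofReal (Real.exp (2 * κ * (Q.eliminate L).trace)) := by
          have hmeas' := (Q.eliminate L).measurable_quadForm
          rw [lintegral_const_mul _ (by fun_prop)]
          gcongr
          exact ih _ (fun i => hμ i.succ) _ hQ'
      _ ≤ _ := by
          rw [← ENNReal.ofReal_mul (Real.exp_pos _).le, ← Real.exp_add]
          refine ENNReal.ofReal_le_ofReal (Real.exp_le_exp.2 ?_)
          rw [Matrix.IsFormBetween.trace_eliminate]
          have h1 := mul_le_mul_of_nonneg_left (hQ.sum_sq_le hg) hL
          have h2 : L * ∑ j : Fin N, Q 0 j.succ ^ 2 ≤ Q 0 0 / 2 := by nlinarith [hQ.diag_nonneg]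
          nlinarith

/-! ### Forms evaluated at linear combinations of rows. -/

namespace Matrix

theorem quadForm_smul {ι : Type*} [Fintype ι] (c : ℝ) (Q : Matrix ι ι ℝ) (x : ι → ℝ) :
    (c • Q).quadForm x = c * Q.quadForm x := by
  simp only [quadForm, smul_apply, smul_eq_mul, Finset.mul_sum, mul_assoc]

theorem quadForm_submatrix {ι κ : Type*} [Fintype ι] [Fintype κ] (e : κ ≃ ι) (Q : Matrix ι ι ℝ)
    (x : ι → ℝ) : (Q.submatrix e e).quadForm (x ∘ e) = Q.quadForm x := by
  simp only [quadForm, submatrix_apply, Function.comp_apply]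
  rw [← e.sum_comp]
  exact Finset.sum_congr rfl fun i _ => (e.sum_comp fun j => Q (e i) j * (x (e i) * x j))

theorem trace_submatrix_equiv {ι κ : Type*} [Fintype ι] [Fintype κ] (e : κ ≃ ι)
    (Q : Matrix ι ι ℝ) : (Q.submatrix e e).trace = Q.trace := by
  simp only [trace, diag_apply, submatrix_apply]
  exact e.sum_comp fun i => Q i i

theorem IsFormBetween.smul {ι : Type*} [Fintype ι] {Q : Matrix ι ι ℝ} {g c : ℝ}
    (h : Q.IsFormBetween g) (hc : 0 ≤ c) : (c • Q).IsFormBetween (c * g) where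
  symm i j := by rw [smul_apply, smul_apply, h.symm]
  nonneg x := by rw [quadForm_smul]; exact mul_nonneg hc (h.nonneg x)
  le x := by rw [quadForm_smul, mul_assoc]; exact mul_le_mul_of_nonneg_left (h.le x) hc

theorem IsFormBetween.submatrix {ι κ : Type*} [Fintype ι] [Fintype κ] {Q : Matrix ι ι ℝ} {g : ℝ}
    (h : Q.IsFormBetween g) (e : κ ≃ ι) : (Q.submatrix e e).IsFormBetween g := by
  have hx : ∀ x : κ → ℝ, x = (x ∘ e.symm) ∘ e := fun x => by ext; simp
  refine ⟨fun i j => h.symm _ _, fun x => ?_, fun x => ?_⟩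
  · rw [hx x, quadForm_submatrix]
    exact h.nonneg _
  · rw [hx x, quadForm_submatrix]
    refine (h.le _).trans_eq ?_
    rw [← e.sum_comp]
    rfl

/-- The form `x ↦ (∑ i, u i • x i)ᵀ Q (∑ i, u i • x i)` on families of vectors. -/
def combForm {ι κ : Type*} (u : ι → ℝ) (Q : Matrix κ κ ℝ) : Matrix (ι × κ) (ι × κ) ℝ :=
  of fun a b => u a.1 * u b.1 * Q a.2 b.2

theorem quadForm_combForm {ι κ : Type*} [Fintype ι] [Fintype κ] (u : ι → ℝ) (Q : Matrix κ κ ℝ)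
    (x : ι × κ → ℝ) :
    (combForm u Q).quadForm x = Q.quadForm fun j => ∑ i, u i * x (i, j) := by
  simp only [quadForm, combForm, of_apply, Fintype.sum_prod_type]
  rw [Finset.sum_comm]
  refine Finset.sum_congr rfl fun j _ => ?_
  have h : ∀ l, Q j l * ((∑ i, u i * x (i, j)) * ∑ i, u i * x (i, l))
      = ∑ i, ∑ k, u i * u k * Q j l * (x (i, j) * x (k, l)) := fun l => by
    rw [Finset.sum_mul_sum, Finset.mul_sum]
    refine Finset.sum_congr rfl fun i _ => ?_
    rw [Finset.mul_sum]
    exact Finset.sum_congr rfl fun k _ => by ring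
  simp_rw [h]
  exact (Finset.sum_congr rfl fun i _ => Finset.sum_comm).trans Finset.sum_comm

theorem trace_combForm {ι κ : Type*} [Fintype ι] [Fintype κ] (u : ι → ℝ) (Q : Matrix κ κ ℝ) :
    (combForm u Q).trace = (∑ i, u i ^ 2) * Q.trace := by
  simp only [trace, diag_apply, combForm, of_apply, Fintype.sum_prod_type, Finset.sum_mul_sum, sq]

theorem IsFormBetween.combForm {ι κ : Type*} [Fintype ι] [Fintype κ] {Q : Matrix κ κ ℝ} {g : ℝ}
    (h : Q.IsFormBetween g) (hg : 0 ≤ g) {u : ι → ℝ} (hu : ∑ i, u i ^ 2 = 1) :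
    (combForm u Q).IsFormBetween g where
  symm a b := by simp only [Matrix.combForm, of_apply, h.symm a.2 b.2]; ring
  nonneg x := by rw [quadForm_combForm]; exact h.nonneg _
  le x := by
    rw [quadForm_combForm]
    refine (h.le _).trans (mul_le_mul_of_nonneg_left ?_ hg)
    rw [Fintype.sum_prod_type, Finset.sum_comm]
    refine Finset.sum_le_sum fun j _ => ?_
    have := Finset.sum_mul_sq_le_sq_mul_sq Finset.univ u fun i => x (i, j)
    rwa [hu, one_mul] at this

end Matrix

/-! ### Tail bounds for quadratic forms. -/

section Tail

variable {Ω ι : Type*} [MeasurableSpace Ω] {P : Measure Ω} [Fintype ι]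
  {ξ : ι → Ω → ℝ} {m g : ℝ}

theorem lintegral_exp_quadForm_comp_le [IsProbabilityMeasure P] (hξ : iIndepFun ξ P)
    (hmeas : ∀ i, AEMeasurable (ξ i) P)
    (hsub : ∀ i, IsStdSubGaussian (P.map (ξ i)) m) (hg : 0 < g) (hgm : g * (16 * m ^ 4) ≤ 1)
    {Q : Matrix ι ι ℝ} (hQ : Q.IsFormBetween g) :
    ∫⁻ ω, ENNReal.ofReal (Real.exp (-Q.quadForm fun i => ξ i ω)) ∂P
        ≤ ENNReal.ofReal (Real.exp (-(Q.trace / 4))) ∧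
      ∫⁻ ω, ENNReal.ofReal (Real.exp (Q.quadForm fun i => ξ i ω)) ∂P
        ≤ ENNReal.ofReal (Real.exp (2 * m ^ 2 * Q.trace)) := by
  set e := (Fintype.equivFin ι).symm
  set μ : Fin (Fintype.card ι) → Measure ℝ := fun k => P.map (ξ (e k)) with hμ
  have hprob : ∀ k, IsProbabilityMeasure (μ k) := fun k =>
    Measure.isProbabilityMeasure_map (hmeas _)
  have hlaw := (hξ.precomp e.injective).map_fun_eq_pi_map fun k => hmeas (e k)
  have hQ' := hQ.submatrix e
  have hmeasQ := (Q.submatrix e e).measurable_quadForm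
  have hq : ∀ ω, Q.quadForm (fun i => ξ i ω)
      = (Q.submatrix e e).quadForm fun k => ξ (e k) ω := fun ω =>
    (Matrix.quadForm_submatrix e Q fun i => ξ i ω).symm
  have hae : AEMeasurable (fun ω k => ξ (e k) ω) P := aemeasurable_pi_lambda _ fun k => hmeas (e k)
  have htrans : ∀ f : (Fin (Fintype.card ι) → ℝ) → ℝ≥0∞, Measurable f →
      ∫⁻ ω, f (fun k => ξ (e k) ω) ∂P = ∫⁻ x, f x ∂(Measure.pi μ) := fun f hf => by
    rw [hμ, ← hlaw, lintegral_map' hf.aemeasurable hae]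
  rw [← Matrix.trace_submatrix_equiv e]
  simp_rw [hq]
  -- The bound `1 ≤ m` is read off one of the laws, so an empty index set is treated apart.
  rcases isEmpty_or_nonempty ι with hι | ⟨⟨i₀⟩⟩
  · have hι' : IsEmpty (Fin (Fintype.card ι)) := e.isEmpty
    simp [Matrix.quadForm, Matrix.trace]
  have hm := (hsub i₀).one_le
  have h24 : m ^ 2 ≤ m ^ 4 := pow_le_pow_right₀ hm (by norm_num)
  have hLg : 8 * m ^ 2 * g ≤ 1 / 2 := by nlinarith
  have ha : ∀ a, 0 ≤ a → a ≤ g → a * (16 * m ^ 4) ≤ 1 := fun a _ hag =>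
    (mul_le_mul_of_nonneg_right hag (by positivity)).trans hgm
  constructor
  · rw [htrans (fun x => ENNReal.ofReal (Real.exp (-(Q.submatrix e e).quadForm x))) (by fun_prop)]
    exact lintegral_exp_neg_quadForm_le hg (by positivity) (by linarith) μ
      (fun k a b h0 h1 => (hsub (e k)).lintegral_exp_neg_quadratic_le h0 (ha a h0 h1) b) _ hQ'
  · rw [htrans (fun x => ENNReal.ofReal (Real.exp ((Q.submatrix e e).quadForm x))) (by fun_prop)]
    exact lintegral_exp_quadForm_le hg (by positivity) hLg (by positivity) μ
      (fun k a b h0 h1 => (hsub (e k)).lintegral_exp_quadratic_le h0 (ha a h0 h1) b) _ hQ'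

theorem measure_le_of_lintegral_exp_le {f : Ω → ℝ} (hf : AEMeasurable f P) {s t : ℝ}
    (h : ∫⁻ ω, ENNReal.ofReal (Real.exp (f ω)) ∂P ≤ ENNReal.ofReal (Real.exp s)) :
    P {ω | t ≤ f ω} ≤ ENNReal.ofReal (Real.exp (s - t)) := by
  have hne : ENNReal.ofReal (Real.exp t) ≠ 0 := by simp [Real.exp_pos]
  have h1 := meas_ge_le_lintegral_div (μ := P) (f := fun ω => ENNReal.ofReal (Real.exp (f ω)))
    (by fun_prop) hne ENNReal.ofReal_ne_top
  have h2 : {ω | t ≤ f ω} ⊆ {ω | ENNReal.ofReal (Real.exp t) ≤ ENNReal.ofReal (Real.exp (f ω))} :=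
    fun ω hω => ENNReal.ofReal_le_ofReal (Real.exp_le_exp.2 hω)
  refine (measure_mono h2).trans (h1.trans ?_)
  rw [Real.exp_sub, ENNReal.ofReal_div_of_pos (Real.exp_pos t)]
  gcongr

theorem aemeasurable_quadForm_comp (hmeas : ∀ i, AEMeasurable (ξ i) P) (Q : Matrix ι ι ℝ) :
    AEMeasurable (fun ω => Q.quadForm fun i => ξ i ω) P :=
  Q.measurable_quadForm.comp_aemeasurable (aemeasurable_pi_lambda _ hmeas)

/-- Chernoff's bound with the form scaled by c = 1/(16m⁴g), the largest scale the moment bound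
allows: the exponent is -c tr/4 + c tr/8. -/
theorem measure_quadForm_le [IsProbabilityMeasure P] (hξ : iIndepFun ξ P)
    (hmeas : ∀ i, AEMeasurable (ξ i) P)
    (hsub : ∀ i, IsStdSubGaussian (P.map (ξ i)) m) (hm : 1 ≤ m) (hg : 0 < g)
    {Q : Matrix ι ι ℝ} (hQ : Q.IsFormBetween g) :
    P {ω | Q.quadForm (fun i => ξ i ω) ≤ Q.trace / 8}
      ≤ ENNReal.ofReal (Real.exp (-(Q.trace / (128 * m ^ 4 * g)))) := by
  have hc : 0 < 1 / (16 * m ^ 4 * g) := by positivity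
  have h := (lintegral_exp_quadForm_comp_le hξ hmeas hsub (g := 1 / (16 * m ^ 4 * g) * g)
    (by positivity) (le_of_eq (by field_simp)) (hQ.smul hc.le)).1
  have h1 := measure_le_of_lintegral_exp_le (t := -(1 / (16 * m ^ 4 * g) * (Q.trace / 8)))
    (aemeasurable_quadForm_comp hmeas _).neg h
  refine (measure_mono fun ω hω => ?_).trans (h1.trans (ENNReal.ofReal_le_ofReal
    (Real.exp_le_exp.2 (le_of_eq ?_))))
  · simp only [Set.mem_ofPred_eq, Pi.neg_apply, Matrix.quadForm_smul, neg_le_neg_iff] at hω ⊢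
    exact mul_le_mul_of_nonneg_left hω hc.le
  · rw [Matrix.trace_smul, smul_eq_mul]
    field_simp
    ring

theorem measure_le_quadForm [IsProbabilityMeasure P] (hξ : iIndepFun ξ P)
    (hmeas : ∀ i, AEMeasurable (ξ i) P)
    (hsub : ∀ i, IsStdSubGaussian (P.map (ξ i)) m) (hm : 1 ≤ m) (hg : 0 < g)
    {Q : Matrix ι ι ℝ} (hQ : Q.IsFormBetween g) :
    P {ω | (2 * m ^ 2 + 1) * Q.trace ≤ Q.quadForm (fun i => ξ i ω)}
      ≤ ENNReal.ofReal (Real.exp (-(Q.trace / (16 * m ^ 4 * g)))) := by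
  have hc : 0 < 1 / (16 * m ^ 4 * g) := by positivity
  have h := (lintegral_exp_quadForm_comp_le hξ hmeas hsub (g := 1 / (16 * m ^ 4 * g) * g)
    (by positivity) (le_of_eq (by field_simp)) (hQ.smul hc.le)).2
  have h1 := measure_le_of_lintegral_exp_le
    (t := 1 / (16 * m ^ 4 * g) * ((2 * m ^ 2 + 1) * Q.trace))
    (aemeasurable_quadForm_comp hmeas _) h
  refine (measure_mono fun ω hω => ?_).trans (h1.trans (ENNReal.ofReal_le_ofReal
    (Real.exp_le_exp.2 (le_of_eq ?_))))
  · simp only [Set.mem_ofPred_eq, Matrix.quadForm_smul] at hω ⊢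
    exact mul_le_mul_of_nonneg_left hω hc.le
  · rw [Matrix.trace_smul, smul_eq_mul]
    field_simp
    ring

end Tail

/-! ### Nets of the sphere. -/

open scoped Function in
/-- Volume bound for the size of a separated subset of the unit ball. -/
theorem card_le_of_separated_unitBall {E : Type*} [NormedAddCommGroup E] [NormedSpace ℝ E]
    [FiniteDimensional ℝ E] {ρ : ℝ} (hρ : 0 < ρ) (hρ' : ρ ≤ 1) (s : Finset E)
    (hs : ∀ c ∈ s, ‖c‖ ≤ 1) (h : ∀ c ∈ s, ∀ d ∈ s, c ≠ d → ρ ≤ ‖c - d‖) :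
    (s.card : ℝ) ≤ (4 / ρ) ^ Module.finrank ℝ E := by
  borelize E
  let μ : Measure E := Measure.addHaar
  have hρ2 : 0 < ρ / 2 := by positivity
  set A := ⋃ c ∈ s, Metric.ball (c : E) (ρ / 2) with hA
  have D : Set.Pairwise (s : Set E) (Disjoint on fun c => Metric.ball (c : E) (ρ / 2)) := by
    rintro c hc d hd hcd
    apply Metric.ball_disjoint_ball
    rw [dist_eq_norm, add_halves]
    exact h c hc d hd hcd
  have A_subset : A ⊆ Metric.ball (0 : E) 2 := by
    refine Set.iUnion₂_subset fun x hx => Metric.ball_subset_ball' ?_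
    rw [dist_zero_right]
    linarith [hs x hx]
  have I : (s.card : ℝ≥0∞) * ENNReal.ofReal ((ρ / 2) ^ Module.finrank ℝ E) * μ (Metric.ball 0 1) ≤
      ENNReal.ofReal (2 ^ Module.finrank ℝ E) * μ (Metric.ball 0 1) :=
    calc
      _ = μ A := by
        rw [hA, measure_biUnion_finset D fun c _ => measurableSet_ball]
        simp only [μ.addHaar_ball_of_pos _ hρ2, Finset.sum_const, nsmul_eq_mul, mul_assoc]
      _ ≤ μ (Metric.ball (0 : E) 2) := measure_mono A_subset
      _ = _ := by simp only [μ.addHaar_ball_of_pos _ zero_lt_two]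
  have J := (ENNReal.mul_le_mul_iff_left (Metric.measure_ball_pos μ 0 zero_lt_one).ne'
    measure_ball_lt_top.ne).1 I
  have K := ENNReal.toReal_le_of_le_ofReal (by positivity) J
  rw [ENNReal.toReal_mul, ENNReal.toReal_natCast, ENNReal.toReal_ofReal (by positivity)] at K
  rw [show 4 / ρ = 2 / (ρ / 2) by field_simp; norm_num, div_pow]
  exact (le_div_iff₀ (by positivity)).2 K

/-- A separated subset of the sphere of greatest cardinality is a net, since a point far from all
its elements could be added. -/
theorem exists_finset_net_sphere {E : Type*} [NormedAddCommGroup E] [NormedSpace ℝ E]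
    [FiniteDimensional ℝ E] {ρ : ℝ} (hρ : 0 < ρ) (hρ' : ρ ≤ 1) :
    ∃ s : Finset E, (s.card : ℝ) ≤ (4 / ρ) ^ Module.finrank ℝ E ∧ (∀ c ∈ s, ‖c‖ = 1) ∧
      ∀ x : E, ‖x‖ = 1 → ∃ c ∈ s, ‖x - c‖ < ρ := by
  classical
  let p : ℕ → Prop := fun k => ∃ s : Finset E, s.card = k ∧ (∀ c ∈ s, ‖c‖ = 1) ∧
    ∀ c ∈ s, ∀ d ∈ s, c ≠ d → ρ ≤ ‖c - d‖
  obtain ⟨b, hb⟩ := exists_nat_ge ((4 / ρ) ^ Module.finrank ℝ E)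
  have hbound : ∀ k, p k → k ≤ b := by
    rintro k ⟨s, rfl, h1, h2⟩
    exact_mod_cast (card_le_of_separated_unitBall hρ hρ' s (fun c hc => (h1 c hc).le) h2).trans hb
  have h0 : p 0 := ⟨∅, by simp, by simp, by simp⟩
  obtain ⟨s, hcard, h1, h2⟩ := Nat.findGreatest_spec (P := p) (Nat.zero_le b) h0
  refine ⟨s, card_le_of_separated_unitBall hρ hρ' s (fun c hc => (h1 c hc).le) h2, h1, ?_⟩
  intro x hx
  by_contra! hcon
  have hxs : x ∉ s := fun hxs => by
    have := hcon x hxs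
    rw [sub_self, norm_zero] at this
    linarith
  have hp : p (s.card + 1) := by
    refine ⟨insert x s, Finset.card_insert_of_notMem hxs, ?_, ?_⟩
    · simp only [Finset.mem_insert]
      rintro c (rfl | hc)
      exacts [hx, h1 c hc]
    · simp only [Finset.mem_insert]
      rintro c (rfl | hc) d (rfl | hd) hcd
      · exact absurd rfl hcd
      · exact hcon d hd
      · rw [norm_sub_rev]; exact hcon c hc
      · exact h2 c hc d hd hcd
  have := Nat.le_findGreatest (hbound _ hp) hp
  omega

/-- A linear map that is bounded above on a net of the sphere is bounded. -/
theorem norm_le_of_net {E F : Type*} [NormedAddCommGroup E] [NormedSpace ℝ E]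
    [FiniteDimensional ℝ E] [NormedAddCommGroup F] [NormedSpace ℝ F] {ρ b : ℝ}
    (hρ' : ρ ≤ 1 / 2) (hb : 0 ≤ b) {s : Set E}
    (hnet : ∀ x : E, ‖x‖ = 1 → ∃ c ∈ s, ‖x - c‖ < ρ) (T : E →ₗ[ℝ] F) (hT : ∀ c ∈ s, ‖T c‖ ≤ b)
    (x : E) : ‖T x‖ ≤ 2 * b * ‖x‖ := by
  set T' := LinearMap.toContinuousLinearMap T with hT'
  have h1 : ∀ x : E, ‖x‖ = 1 → ‖T x‖ ≤ b + ‖T'‖ * ρ := fun x hx => by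
    obtain ⟨c, hc, hxc⟩ := hnet x hx
    have h2 : T x = T c + T' (x - c) := by simp [hT']
    rw [h2]
    refine (norm_add_le _ _).trans (add_le_add (hT c hc) ((T'.le_opNorm _).trans ?_))
    gcongr
  have h3 : ‖T'‖ ≤ b + ‖T'‖ * ρ := by
    rcases subsingleton_or_nontrivial E with hE | hE
    · have : T' = 0 := by ext x; rw [Subsingleton.elim x 0]; simp
      rw [this]; simpa using hb
    · obtain ⟨x, hx⟩ := exists_norm_eq E (zero_le_one (α := ℝ))
      have hnn : 0 ≤ b + ‖T'‖ * ρ := (norm_nonneg _).trans (h1 x hx)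
      refine ContinuousLinearMap.opNorm_le_of_unit_norm hnn fun x hx => h1 x hx
  have h4 : ‖T'‖ ≤ 2 * b := by nlinarith [norm_nonneg T']
  exact (T'.le_opNorm x).trans (by gcongr)

/-- A linear map that is bounded below on a net of the sphere is bounded below. -/
theorem le_norm_of_net {E F : Type*} [NormedAddCommGroup E] [NormedSpace ℝ E]
    [NormedAddCommGroup F] [NormedSpace ℝ F] {ρ a b : ℝ} (hb : 0 ≤ b) (hab : b * ρ ≤ a / 2)
    {s : Set E} (hnet : ∀ x : E, ‖x‖ = 1 → ∃ c ∈ s, ‖x - c‖ < ρ) (T : E →ₗ[ℝ] F)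
    (hT : ∀ c ∈ s, a ≤ ‖T c‖) (hT' : ∀ x, ‖T x‖ ≤ b * ‖x‖) (x : E) : a / 2 * ‖x‖ ≤ ‖T x‖ := by
  rcases eq_or_ne x 0 with rfl | hx
  · simp
  have hx' : 0 < ‖x‖ := norm_pos_iff.2 hx
  have h1 : ∀ x : E, ‖x‖ = 1 → a / 2 ≤ ‖T x‖ := fun x hx => by
    obtain ⟨c, hc, hxc⟩ := hnet x hx
    have h4 : b * ‖x - c‖ ≤ b * ρ := by gcongr
    have h5 := hT c hc
    have h7 := norm_sub_norm_le (T c) (T x)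
    rw [← map_sub] at h7
    have h8 := hT' (c - x)
    rw [norm_sub_rev c x] at h8
    linarith
  have h2 := h1 (‖x‖⁻¹ • x) (by rw [norm_smul, norm_inv, norm_norm, inv_mul_cancel₀ hx'.ne'])
  rw [map_smul, norm_smul, norm_inv, norm_norm] at h2
  rw [← le_div_iff₀ hx', div_eq_inv_mul ‖T x‖]
  exact h2

/-! ### Deterministic bounds for least squares. -/

/-- The adjoint S is bounded below, so TS is invertible and x = Su with TSu = v works: ‖Su‖² = ⟨v,
u⟩ ≤ ‖v‖‖Su‖/s. -/
theorem exists_preimage_norm_le {E F : Type*} [NormedAddCommGroup E] [InnerProductSpace ℝ E]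
    [NormedAddCommGroup F] [InnerProductSpace ℝ F] [FiniteDimensional ℝ F] (T : E →ₗ[ℝ] F)
    (S : F →ₗ[ℝ] E) (hTS : ∀ x u, inner ℝ (T x) u = inner ℝ x (S u)) {s : ℝ} (hs : 0 < s)
    (hS : ∀ u, s * ‖u‖ ≤ ‖S u‖) (v : F) : ∃ x, T x = v ∧ ‖x‖ ≤ ‖v‖ / s := by
  have hinj : Function.Injective (T ∘ₗ S) := by
    rw [← LinearMap.ker_eq_bot, LinearMap.ker_eq_bot']
    intro u hu
    have h1 : inner ℝ (S u) (S u) = (0 : ℝ) := by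
      rw [← hTS, ← LinearMap.comp_apply, hu, inner_zero_left]
    have h2 := hS u
    rw [inner_self_eq_zero.1 h1, norm_zero] at h2
    exact norm_eq_zero.1 (by nlinarith [norm_nonneg u])
  obtain ⟨u, hu⟩ := LinearMap.injective_iff_surjective.1 hinj v
  refine ⟨S u, hu, ?_⟩
  rw [le_div_iff₀ hs]
  have h1 : ‖S u‖ * ‖S u‖ = inner ℝ v u := by
    rw [← real_inner_self_eq_norm_mul_norm, ← hTS, ← hu]; rfl
  have h2 := real_inner_le_norm v u
  have h3 := hS u
  rcases (norm_nonneg (S u)).eq_or_lt with h0 | h0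
  · rw [← h0]; simp
  · nlinarith [norm_nonneg v, mul_le_mul_of_nonneg_left h3 (norm_nonneg v)]

theorem Matrix.inner_toEuclideanLin_transpose {n p : ℕ} (X : Matrix (Fin n) (Fin p) ℝ)
    (x : EuclideanSpace ℝ (Fin p)) (u : EuclideanSpace ℝ (Fin n)) :
    inner ℝ (Matrix.toEuclideanLin X x) u = inner ℝ x (Matrix.toEuclideanLin X.transpose u) := by
  rw [← Matrix.conjTranspose_eq_transpose_of_trivial,
    Matrix.toEuclideanLin_conjTranspose_eq_adjoint, LinearMap.adjoint_inner_right]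

/-- Adding to a a small preimage of its residual gives an exact fit, hence a competitor for the
minimum norm. -/
theorem norm_minNormLeastSquares_le {n p : ℕ} {X : Matrix (Fin n) (Fin p) ℝ} {s : ℝ} (hs : 0 < s)
    (hX : ∀ u, s * ‖u‖ ≤ ‖Matrix.toEuclideanLin X.transpose u‖) (y : EuclideanSpace ℝ (Fin n))
    (a : EuclideanSpace ℝ (Fin p)) :
    ‖minNormLeastSquares X y‖ ≤ ‖a‖ + ‖y - Matrix.toEuclideanLin X a‖ / s := by
  obtain ⟨x, hx, hxn⟩ := exists_preimage_norm_le _ _ X.inner_toEuclideanLin_transpose hs hX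
    (y - Matrix.toEuclideanLin X a)
  have hls : IsLeastSquares X y (a + x) := fun u => by
    rw [map_add, hx, add_sub_cancel, sub_self, norm_zero]
    exact norm_nonneg _
  exact ((isMinNormLeastSquares_minNormLeastSquares X y).2 _ hls).trans
    ((norm_add_le _ _).trans (by gcongr))

theorem norm_toEuclideanLin_le_of_transpose {n p : ℕ} {X : Matrix (Fin n) (Fin p) ℝ} {b : ℝ}
    (hb : 0 ≤ b) (hX : ∀ u, ‖Matrix.toEuclideanLin X.transpose u‖ ≤ b * ‖u‖)
    (a : EuclideanSpace ℝ (Fin p)) : ‖Matrix.toEuclideanLin X a‖ ≤ b * ‖a‖ := by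
  have h1 : ‖Matrix.toEuclideanLin X a‖ * ‖Matrix.toEuclideanLin X a‖
      ≤ ‖a‖ * (b * ‖Matrix.toEuclideanLin X a‖) := by
    rw [← real_inner_self_eq_norm_mul_norm, Matrix.inner_toEuclideanLin_transpose]
    refine (real_inner_le_norm _ _).trans ?_
    gcongr
    exact hX _
  rcases (norm_nonneg (Matrix.toEuclideanLin X a)).eq_or_lt with h0 | h0
  · rw [← h0]; positivity
  · nlinarith

/-! ### The signal eigenvalue and a good coefficient vector. -/

theorem antitone_ne_zero_iff_lt {d K : ℕ} {f : Fin d → ℝ} (hf : Antitone f) (h0 : ∀ i, 0 ≤ f i)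
    (hK : Fintype.card {i // f i ≠ 0} = K) (i : Fin d) : f i ≠ 0 ↔ (i : ℕ) < K := by
  classical
  rw [Fintype.card_subtype] at hK
  constructor
  · intro hi
    have h1 : (Finset.univ.filter fun j : Fin d => j ≤ i) ⊆ Finset.univ.filter fun j => f j ≠ 0 := by
      intro j hj
      simp only [Finset.mem_filter, Finset.mem_univ, true_and] at hj ⊢
      exact (((h0 i).lt_of_ne hi.symm).trans_le (hf hj)).ne'
    have h2 := Finset.card_le_card h1
    rw [hK, show (Finset.univ.filter fun j : Fin d => j ≤ i) = Finset.Iic i by ext; simp,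
      Fin.card_Iic] at h2
    omega
  · intro hi hfi
    have h1 : (Finset.univ.filter fun j => f j ≠ 0) ⊆ Finset.univ.filter fun j : Fin d => j < i := by
      intro j hj
      simp only [Finset.mem_filter, Finset.mem_univ, true_and] at hj ⊢
      by_contra hij
      exact hj (le_antisymm ((hf (not_lt.1 hij)).trans hfi.le) (h0 j))
    have h2 := Finset.card_le_card h1
    rw [hK, show (Finset.univ.filter fun j : Fin d => j < i) = Finset.Iio i by ext; simp,
      Fin.card_Iio] at h2
    omega

/-- At rank K, λ_K is the least nonzero eigenvalue, so N is at least λ_K on its own range; the claim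
is checked coordinatewise in an eigenbasis. -/
theorem Matrix.PosSemidef.eigenvalue_mul_norm_sq_le {p K : ℕ} {N : Matrix (Fin p) (Fin p) ℝ}
    (hN : N.PosSemidef) (hK : 1 ≤ K) (hrank : N.rank = K) :
    0 < orderedEigenvalue N K ∧ ∀ z : EuclideanSpace ℝ (Fin p),
      orderedEigenvalue N K * ‖Matrix.toEuclideanLin N z‖ ^ 2
        ≤ inner ℝ (Matrix.toEuclideanLin N z)
            (Matrix.toEuclideanLin N (Matrix.toEuclideanLin N z)) := by
  have hKp : K ≤ p := hrank ▸ (N.rank_le_width)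
  have hH := hN.1
  have hdef : orderedEigenvalue N K
      = hH.eigenvalues₀ ⟨K - 1, by rw [Fintype.card_fin]; omega⟩ := by
    rw [orderedEigenvalue, dif_pos ⟨hH, hK, hKp⟩]
  set e := (Fintype.equivOfCardEq (Fintype.card_fin (Fintype.card (Fin p)))).symm
  have h0 : ∀ i, 0 ≤ hH.eigenvalues₀ i := fun i => by
    have := hN.eigenvalues_nonneg
      ((Fintype.equivOfCardEq (Fintype.card_fin (Fintype.card (Fin p)))) i)
    simpa [Matrix.IsHermitian.eigenvalues] using this
  have hcard : Fintype.card {i // hH.eigenvalues₀ i ≠ 0} = K := by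
    rw [← hrank, hH.rank_eq_card_non_zero_eigs]
    exact (Fintype.card_congr (Equiv.subtypeEquiv e fun i => Iff.rfl)).symm
  have hiff := antitone_ne_zero_iff_lt hH.eigenvalues₀_antitone h0 hcard
  have hpos : 0 < orderedEigenvalue N K := by
    rw [hdef]
    exact (h0 _).lt_of_ne ((hiff _).2 (by simp only; omega)).symm
  refine ⟨hpos, fun z => ?_⟩
  have hT := Matrix.isSymmetric_toEuclideanLin_iff.mpr hH
  set T := Matrix.toEuclideanLin N with hTdef
  set v := hT.eigenvectorBasis finrank_euclideanSpace with hv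
  have hTv : ∀ i (x : EuclideanSpace ℝ (Fin p)),
      inner ℝ (v i) (T x) = hH.eigenvalues₀ i * inner ℝ (v i) x := fun i x => by
    have := hT.eigenvectorBasis_apply_self_apply finrank_euclideanSpace x i
    rw [OrthonormalBasis.repr_apply_apply, OrthonormalBasis.repr_apply_apply] at this
    exact this
  rw [← real_inner_self_eq_norm_sq, ← v.sum_inner_mul_inner, ← v.sum_inner_mul_inner, Finset.mul_sum]
  refine Finset.sum_le_sum fun i _ => ?_
  rw [real_inner_comm, hTv i (T z), hTv i z]
  rcases eq_or_ne (hH.eigenvalues₀ i) 0 with hi | hi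
  · simp [hi]
  · have h1 : orderedEigenvalue N K ≤ hH.eigenvalues₀ i := by
      rw [hdef]
      refine hH.eigenvalues₀_antitone ?_
      have := (hiff i).1 hi
      exact Fin.mk_le_mk.2 (by omega)
    have := mul_le_mul_of_nonneg_right h1 (mul_self_nonneg (hH.eigenvalues₀ i * inner ℝ (v i) z))
    linarith

/-- A coefficient vector reproducing the signal, with norm controlled by the signal strength. -/
theorem exists_transpose_mulVec_eq {p K : ℕ} (hK : 1 ≤ K) {A : Matrix (Fin p) (Fin K) ℝ}
    {S : Matrix (Fin K) (Fin K) ℝ} (hS : S.PosSemidef) (hA : A.rank = K) (hS' : S.rank = K)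
    (β : Fin K → ℝ) : ∃ a : EuclideanSpace ℝ (Fin p), A.transpose.mulVec a = β ∧
      ‖a‖ ^ 2 ≤ (β ⬝ᵥ S.mulVec β) / orderedEigenvalue (A * S * A.transpose) K := by
  have hunit : ∀ B : Matrix (Fin K) (Fin K) ℝ, B.rank = K → IsUnit B.det := fun B hB => by
    rw [← Matrix.isUnit_iff_isUnit_det, ← Matrix.mulVec_surjective_iff_isUnit]
    refine LinearMap.range_eq_top.1 (Submodule.eq_top_of_finrank_eq (S := B.mulVecLin.range) ?_)
    exact hB.trans (Module.finrank_fin_fun ℝ).symm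
  set G := A.transpose * A with hG
  have hGu : IsUnit G.det := hunit G (by rw [hG, Matrix.rank_transpose_mul_self, hA])
  have hSu := hunit S hS'
  have hN : (A * S * A.transpose).PosSemidef := by
    have := hS.mul_mul_conjTranspose_same A
    rwa [Matrix.conjTranspose_eq_transpose_of_trivial] at this
  have hrank : (A * S * A.transpose).rank = K := by
    refine le_antisymm ?_ ?_
    · exact (Matrix.rank_mul_le_left _ _).trans ((Matrix.rank_mul_le_left _ _).trans hA.le)
    · have h1 : (G * S * G).rank = K := by
        rw [Matrix.rank_mul_eq_left_of_isUnit_det _ _ hGu,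
          Matrix.rank_mul_eq_left_of_isUnit_det _ _ hSu, hG, Matrix.rank_transpose_mul_self, hA]
      have h2 : G * S * G = A.transpose * (A * S * A.transpose * A) := by
        simp only [hG, Matrix.mul_assoc]
      rw [h2] at h1
      refine h1.symm.trans_le ?_
      exact (Matrix.rank_mul_le_right _ _).trans (Matrix.rank_mul_le_left _ _)
  obtain ⟨hpos, hle⟩ := hN.eigenvalue_mul_norm_sq_le hK hrank
  -- Chosen so that AΣAᵀz = AG⁻¹β, which puts the candidate in the range where the eigenvalue bound
  -- applies.
  set z : EuclideanSpace ℝ (Fin p) := WithLp.toLp 2 (A.mulVec ((G⁻¹ * S⁻¹ * G⁻¹).mulVec β)) with hz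
  have hNz : (A * S * A.transpose).mulVec z = A.mulVec (G⁻¹.mulVec β) := by
    simp only [hz, Matrix.mulVec_mulVec]
    congr 1
    calc A * S * A.transpose * (A * (G⁻¹ * S⁻¹ * G⁻¹)) = A * (S * (G * G⁻¹) * S⁻¹) * G⁻¹ := by
          simp only [hG, Matrix.mul_assoc]
      _ = A * G⁻¹ := by
          rw [Matrix.mul_nonsing_inv _ hGu, Matrix.mul_one, Matrix.mul_nonsing_inv _ hSu,
            Matrix.mul_one]
  set a := Matrix.toEuclideanLin (A * S * A.transpose) z with ha
  have ha' : a.ofLp = A.mulVec (G⁻¹.mulVec β) := hNz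
  have hAa : A.transpose.mulVec a = β := by
    rw [ha', Matrix.mulVec_mulVec, Matrix.mulVec_mulVec, ← hG, Matrix.mul_nonsing_inv _ hGu,
      Matrix.one_mulVec]
  refine ⟨a, hAa, ?_⟩
  rw [le_div_iff₀ hpos, mul_comm]
  refine (hle z).trans_eq ?_
  have h3 : (Matrix.toEuclideanLin (A * S * A.transpose) a).ofLp = A.mulVec (S.mulVec β) := by
    show (A * S * A.transpose).mulVec a.ofLp = _
    rw [← Matrix.mulVec_mulVec, hAa, ← Matrix.mulVec_mulVec]
  rw [EuclideanSpace.inner_eq_star_dotProduct, h3, star_trivial, dotProduct_comm,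
    Matrix.dotProduct_mulVec, ← Matrix.mulVec_transpose, hAa]

/-! ### Covariance, Gram matrices and traces under projection. -/

theorem posSemidef_covarianceMatrix {Ω : Type*} [MeasurableSpace Ω] {P : Measure Ω}
    [IsFiniteMeasure P] {d : ℕ} {V : Ω → Fin d → ℝ} (hV : ∀ j, MemLp (fun ω => V ω j) 2 P) :
    (covarianceMatrix P V).PosSemidef := by
  refine Matrix.PosSemidef.of_dotProduct_mulVec_nonneg ?_ fun x => ?_
  · ext j k
    simp only [covarianceMatrix, Matrix.conjTranspose_apply, Matrix.of_apply, star_trivial]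
    exact covariance_comm _ _
  · have hx : ∀ j, MemLp (fun ω => x j * V ω j) 2 P := fun j => (hV j).const_mul (x j)
    have hsum : MemLp (fun ω => ∑ j, x j * V ω j) 2 P := memLp_finsetSum _ fun j _ => hx j
    have h := covariance_fun_sum_fun_sum hx hx
    rw [covariance_self hsum.aestronglyMeasurable.aemeasurable] at h
    have h2 : star x ⬝ᵥ (covarianceMatrix P V).mulVec x = Var[fun ω => ∑ j, x j * V ω j; P] := by
      rw [h]
      simp only [dotProduct, Matrix.mulVec, covarianceMatrix, Matrix.of_apply, star_trivial,
        Finset.mul_sum, covariance_const_mul_left, covariance_const_mul_right]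
      exact Finset.sum_congr rfl fun i _ => Finset.sum_congr rfl fun j _ => by ring
    rw [h2]
    exact variance_nonneg _ _

section Gram

variable {p : ℕ} {F : Type*} [NormedAddCommGroup F] [InnerProductSpace ℝ F]

theorem Matrix.quadForm_gram {ι : Type*} [Fintype ι] (v : ι → F) (x : ι → ℝ) :
    (Matrix.gram ℝ v).quadForm x = ‖∑ j, x j • v j‖ ^ 2 := by
  rw [← real_inner_self_eq_norm_sq, sum_inner]
  simp only [inner_sum, real_inner_smul_left, real_inner_smul_right, Matrix.quadForm,
    Matrix.gram_apply]
  exact Finset.sum_congr rfl fun i _ => Finset.sum_congr rfl fun j _ => by ring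

/-- The Gram matrix of the images of the standard basis. -/
noncomputable def LinearMap.gramMatrix (R : EuclideanSpace ℝ (Fin p) →ₗ[ℝ] F) : Matrix (Fin p) (Fin p) ℝ :=
  Matrix.gram ℝ fun j => R (EuclideanSpace.basisFun (Fin p) ℝ j)

theorem LinearMap.quadForm_gramMatrix (R : EuclideanSpace ℝ (Fin p) →ₗ[ℝ] F) (x : Fin p → ℝ) :
    R.gramMatrix.quadForm x = ‖R (WithLp.toLp 2 x)‖ ^ 2 := by
  have h := (EuclideanSpace.basisFun (Fin p) ℝ).sum_repr (WithLp.toLp 2 x)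
  rw [LinearMap.gramMatrix, Matrix.quadForm_gram]
  conv_rhs => rw [← h]
  simp

theorem LinearMap.trace_gramMatrix (R : EuclideanSpace ℝ (Fin p) →ₗ[ℝ] F) :
    R.gramMatrix.trace = ∑ j, ‖R (EuclideanSpace.basisFun (Fin p) ℝ j)‖ ^ 2 := by
  simp only [Matrix.trace, Matrix.diag_apply, LinearMap.gramMatrix, Matrix.gram_apply,
    real_inner_self_eq_norm_sq]

theorem LinearMap.gramMatrix_isFormBetween {R : EuclideanSpace ℝ (Fin p) →ₗ[ℝ] F} {g : ℝ}
    (hR : ∀ x, ‖R x‖ ^ 2 ≤ g * ‖x‖ ^ 2) : R.gramMatrix.IsFormBetween g where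
  symm i j := real_inner_comm _ _
  nonneg x := by rw [R.quadForm_gramMatrix]; positivity
  le x := by
    rw [R.quadForm_gramMatrix]
    refine (hR _).trans_eq ?_
    rw [EuclideanSpace.real_norm_sq_eq]

end Gram

/-- Projecting away from a subspace of dimension `K` costs at most `K g` of the trace. -/
theorem sum_norm_sq_le_sum_starProjection {E ι : Type*} [NormedAddCommGroup E]
    [InnerProductSpace ℝ E] [FiniteDimensional ℝ E] [Fintype ι] (e : OrthonormalBasis ι ℝ E)
    {S : E →ₗ[ℝ] E} (hS : S.IsSymmetric) {g : ℝ} (hg : ∀ x, ‖S x‖ ^ 2 ≤ g * ‖x‖ ^ 2)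
    (W : Submodule ℝ E) :
    ∑ j, ‖S (e j)‖ ^ 2
      ≤ ∑ j, ‖Wᗮ.starProjection (S (e j))‖ ^ 2 + Module.finrank ℝ W * g := by
  have h1 : ∀ x, ‖x‖ ^ 2 = ‖W.starProjection x‖ ^ 2 + ‖Wᗮ.starProjection x‖ ^ 2 := fun x =>
    W.norm_sq_eq_add_norm_sq_projection x
  set b := stdOrthonormalBasis ℝ W
  have h2 : ∀ x, ‖W.starProjection x‖ ^ 2 = ∑ k, inner ℝ (b k : E) x ^ 2 := fun x => by
    have h3 := b.sum_sq_norm_inner_right (W.orthogonalProjectionOnto x)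
    have h4 : ‖W.starProjection x‖ = ‖W.orthogonalProjectionOnto x‖ := rfl
    rw [h4, ← h3]
    refine Finset.sum_congr rfl fun k _ => ?_
    rw [Real.norm_eq_abs, sq_abs, W.inner_orthogonalProjectionOnto_eq_of_mem_left]
  -- The Hilbert–Schmidt norms of P_W S and S P_W agree: expand in both bases, move S across by
  -- symmetry and resum by Parseval.
  have h3 : ∑ j, ‖W.starProjection (S (e j))‖ ^ 2 = ∑ k, ‖S (b k)‖ ^ 2 := by
    simp_rw [h2]
    rw [Finset.sum_comm]
    refine Finset.sum_congr rfl fun k _ => ?_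
    rw [← e.sum_sq_norm_inner_left]
    exact Finset.sum_congr rfl fun j _ => by rw [Real.norm_eq_abs, sq_abs, hS]
  have h4 : ∑ k, ‖S (b k)‖ ^ 2 ≤ Module.finrank ℝ W * g := by
    refine (Finset.sum_le_sum fun k _ => hg (b k)).trans_eq ?_
    have hb : ∀ k, ‖(b k : E)‖ = 1 := fun k => b.orthonormal.1 k
    simp [hb]
  calc _ = ∑ j, ‖W.starProjection (S (e j))‖ ^ 2 + ∑ j, ‖Wᗮ.starProjection (S (e j))‖ ^ 2 := by
        rw [← Finset.sum_add_distrib]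
        exact Finset.sum_congr rfl fun j _ => h1 _
    _ ≤ _ := by linarith

/-! ### Well-spread noise matrices. -/

/-- `e` has no direction stretched by more than `b`, and every direction keeps a component of
relative size `a` orthogonal to `W`. -/
def IsWellSpread {n p : ℕ} (W : Submodule ℝ (EuclideanSpace ℝ (Fin p))) (a b : ℝ)
    (e : Matrix (Fin n) (Fin p) ℝ) : Prop :=
  (∀ u, ‖Matrix.toEuclideanLin e.transpose u‖ ≤ b * ‖u‖) ∧
    ∀ u, a * ‖u‖ ≤ ‖Wᗮ.starProjection (Matrix.toEuclideanLin e.transpose u)‖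

/-- Closedness gives measurability, which lets the probability of this event be computed from the
law of the noise alone. -/
theorem isClosed_isWellSpread {n p : ℕ} (W : Submodule ℝ (EuclideanSpace ℝ (Fin p))) (a b : ℝ) :
    IsClosed {e : Fin n → Fin p → ℝ | IsWellSpread W a b (Matrix.of e)} := by
  have hc : ∀ u : EuclideanSpace ℝ (Fin n), Continuous fun e : Fin n → Fin p → ℝ =>
      Matrix.toEuclideanLin (Matrix.of e).transpose u := fun u => by
    simp only [Matrix.toLpLin_apply]
    refine (PiLp.continuous_toLp 2 _).comp ?_
    refine Continuous.matrix_mulVec ?_ continuous_const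
    exact Continuous.matrix_transpose continuous_id
  rw [show {e : Fin n → Fin p → ℝ | IsWellSpread W a b (Matrix.of e)}
    = (⋂ u, {e | ‖Matrix.toEuclideanLin (Matrix.of e).transpose u‖ ≤ b * ‖u‖}) ∩
      ⋂ u, {e | a * ‖u‖ ≤ ‖Wᗮ.starProjection (Matrix.toEuclideanLin (Matrix.of e).transpose u)‖}
      by ext; simp only [IsWellSpread, Set.mem_ofPred_eq, Set.mem_inter_iff, Set.mem_iInter]]
  exact (isClosed_iInter fun u => isClosed_le (hc u).norm continuous_const).inter
    (isClosed_iInter fun u =>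
      isClosed_le continuous_const ((Wᗮ.starProjection.continuous.comp (hc u)).norm))

theorem toEuclideanLin_transpose_of_mulVec {n p : ℕ} (S : Matrix (Fin p) (Fin p) ℝ)
    (x : Fin n → Fin p → ℝ) (u : EuclideanSpace ℝ (Fin n)) :
    Matrix.toEuclideanLin (Matrix.of fun i => S.mulVec (x i)).transpose u
      = Matrix.toEuclideanLin S (WithLp.toLp 2 fun j => ∑ i, u i * x i j) := by
  ext j
  simp only [Matrix.toLpLin_apply, Matrix.mulVec, dotProduct, Matrix.transpose_apply,
    Matrix.of_apply, Finset.mul_sum, Finset.sum_mul]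
  rw [Finset.sum_comm]
  exact Finset.sum_congr rfl fun k _ => Finset.sum_congr rfl fun i _ => by ring

theorem measure_not_isWellSpread_le {Ω : Type*} [MeasurableSpace Ω] {P : Measure Ω}
    [IsProbabilityMeasure P] {n p : ℕ} {ξ : Fin n × Fin p → Ω → ℝ} (hξ : iIndepFun ξ P)
    (hmeas : ∀ i, AEMeasurable (ξ i) P) {m : ℝ} (hm : 1 ≤ m)
    (hsub : ∀ i, IsStdSubGaussian (P.map (ξ i)) m) {S : Matrix (Fin p) (Fin p) ℝ}
    (hS : S.IsHermitian) {g : ℝ} (hg : 0 < g)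
    (hSg : ∀ x, ‖Matrix.toEuclideanLin S x‖ ^ 2 ≤ g * ‖x‖ ^ 2)
    (W : Submodule ℝ (EuclideanSpace ℝ (Fin p))) {τ : ℝ}
    (hτ : τ = (Matrix.toEuclideanLin S).gramMatrix.trace)
    (hW : 2 * (Module.finrank ℝ W * g) ≤ τ)
    (hn : 256 * m ^ 4 * (Real.log (128 * m) + 1) * n ≤ τ / g) :
    P {ω | ¬ IsWellSpread W (√τ / 8) (4 * m * √τ)
        (Matrix.of fun i => S.mulVec fun j => ξ (i, j) ω)}
      ≤ ENNReal.ofReal (2 * Real.exp (-n)) := by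
  -- The radius makes the upper bound 4m√τ times ρ equal to √τ/8, half of the lower bound √τ/4
  -- available on the net.
  obtain ⟨s, hcard, hs1, hnet⟩ := exists_finset_net_sphere (E := EuclideanSpace ℝ (Fin n))
    (ρ := 1 / (32 * m)) (by positivity) (by rw [div_le_one (by positivity)]; linarith)
  rw [finrank_euclideanSpace_fin, show 4 / (1 / (32 * m)) = 128 * m by field_simp; norm_num]
    at hcard
  have hτ0 : 0 ≤ τ := le_trans (by positivity) hW
  set T := Matrix.toEuclideanLin S with hT
  set R : EuclideanSpace ℝ (Fin p) →ₗ[ℝ] EuclideanSpace ℝ (Fin p) :=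
    Wᗮ.starProjection.toLinearMap ∘ₗ T with hR
  have hRT : ∀ x, ‖R x‖ ≤ ‖T x‖ := fun x => Wᗮ.norm_starProjection_apply_le (T x)
  have hRg : ∀ x, ‖R x‖ ^ 2 ≤ g * ‖x‖ ^ 2 := fun x =>
    (pow_le_pow_left₀ (norm_nonneg _) (hRT x) 2).trans (hSg x)
  have htr : τ / 2 ≤ R.gramMatrix.trace := by
    have h := sum_norm_sq_le_sum_starProjection (EuclideanSpace.basisFun (Fin p) ℝ)
      (Matrix.isSymmetric_toEuclideanLin_iff.mpr hS) hSg W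
    rw [hτ] at hW ⊢
    rw [LinearMap.trace_gramMatrix] at hW ⊢
    rw [LinearMap.trace_gramMatrix]
    change _ ≤ ∑ j, ‖R (EuclideanSpace.basisFun (Fin p) ℝ j)‖ ^ 2 + _ at h
    linarith
  set up : EuclideanSpace ℝ (Fin n) → Set Ω := fun c =>
    {ω | (2 * m ^ 2 + 1) * (Matrix.combForm c T.gramMatrix).trace
      ≤ (Matrix.combForm c T.gramMatrix).quadForm fun i => ξ i ω} with hup
  set lo : EuclideanSpace ℝ (Fin n) → Set Ω := fun c =>
    {ω | (Matrix.combForm c R.gramMatrix).quadForm (fun i => ξ i ω)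
      ≤ (Matrix.combForm c R.gramMatrix).trace / 8} with hlo
  have hsq : ∀ c ∈ s, ∑ i, c i ^ 2 = 1 := fun c hc => by
    rw [← EuclideanSpace.real_norm_sq_eq, hs1 c hc, one_pow]
  -- A common tail for both events: the projected form has trace at least τ/2, turning 128 into 256;
  -- the upper tail is smaller still.
  set r := Real.exp (-(τ / (256 * m ^ 4 * g))) with hr
  have hPup : ∀ c ∈ s, P (up c) ≤ ENNReal.ofReal r := fun c hc => by
    refine (measure_le_quadForm hξ hmeas hsub hm hg
      ((LinearMap.gramMatrix_isFormBetween hSg).combForm hg.le (hsq c hc))).trans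
      (ENNReal.ofReal_le_ofReal (Real.exp_le_exp.2 (neg_le_neg ?_)))
    rw [Matrix.trace_combForm, hsq c hc, one_mul, ← hτ]
    gcongr
    norm_num
  have hPlo : ∀ c ∈ s, P (lo c) ≤ ENNReal.ofReal r := fun c hc => by
    refine (measure_quadForm_le hξ hmeas hsub hm hg
      ((LinearMap.gramMatrix_isFormBetween hRg).combForm hg.le (hsq c hc))).trans
      (ENNReal.ofReal_le_ofReal (Real.exp_le_exp.2 (neg_le_neg ?_)))
    rw [Matrix.trace_combForm, hsq c hc, one_mul]
    calc τ / (256 * m ^ 4 * g) = (τ / 2) / (128 * m ^ 4 * g) := by field_simp; ring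
      _ ≤ _ := by gcongr
  have hsubset : {ω | ¬ IsWellSpread W (√τ / 8) (4 * m * √τ)
      (Matrix.of fun i => S.mulVec fun j => ξ (i, j) ω)} ⊆ ⋃ c ∈ s, (up c ∪ lo c) := by
    intro ω hω
    by_contra hcon
    simp only [Set.mem_iUnion, Set.mem_union, not_exists, not_or] at hcon
    refine hω ?_
    set e : Matrix (Fin n) (Fin p) ℝ := Matrix.of fun i => S.mulVec fun j => ξ (i, j) ω with he
    have hTe : ∀ u, Matrix.toEuclideanLin e.transpose u
        = T (WithLp.toLp 2 fun j => ∑ i, u i * ξ (i, j) ω) :=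
      toEuclideanLin_transpose_of_mulVec S fun i j => ξ (i, j) ω
    have hupper : ∀ c ∈ (s : Set (EuclideanSpace ℝ (Fin n))),
        ‖Matrix.toEuclideanLin e.transpose c‖ ≤ 2 * m * √τ := fun c hc => by
      have h := (hcon c hc).1
      simp only [hup, Set.mem_ofPred_eq, not_le] at h
      rw [Matrix.quadForm_combForm, LinearMap.quadForm_gramMatrix, ← hTe, Matrix.trace_combForm,
        hsq c hc, one_mul, ← hτ] at h
      refine abs_le_of_sq_le_sq' ?_ (by positivity) |>.2
      rw [mul_pow, Real.sq_sqrt hτ0]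
      nlinarith [mul_nonneg hτ0 (sub_nonneg.2 (one_le_pow₀ hm : 1 ≤ m ^ 2))]
    have hlower : ∀ c ∈ (s : Set (EuclideanSpace ℝ (Fin n))), √τ / 4 ≤
        ‖(Wᗮ.starProjection.toLinearMap ∘ₗ Matrix.toEuclideanLin e.transpose) c‖ := fun c hc => by
      have h := (hcon c hc).2
      simp only [hlo, Set.mem_ofPred_eq, not_le] at h
      have hc' : (Wᗮ.starProjection.toLinearMap ∘ₗ Matrix.toEuclideanLin e.transpose) c
          = R (WithLp.toLp 2 fun j => ∑ i, c i * ξ (i, j) ω) := by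
        rw [LinearMap.comp_apply, hTe]; rfl
      rw [Matrix.quadForm_combForm, LinearMap.quadForm_gramMatrix, ← hc', Matrix.trace_combForm,
        hsq c hc, one_mul] at h
      refine abs_le_of_sq_le_sq' ?_ (norm_nonneg _) |>.2
      rw [div_pow, Real.sq_sqrt hτ0]
      linarith
    have hρ : 1 / (32 * m) ≤ 1 / 2 := one_div_le_one_div_of_le (by norm_num) (by linarith)
    have hU := norm_le_of_net hρ (by positivity) (fun x hx => hnet x hx) _ hupper
    have hU' : ∀ u, ‖Matrix.toEuclideanLin e.transpose u‖ ≤ 4 * m * √τ * ‖u‖ := fun u =>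
      (hU u).trans_eq (by ring)
    refine ⟨hU', fun u => ?_⟩
    have hL := le_norm_of_net (b := 4 * m * √τ) (a := √τ / 4) (ρ := 1 / (32 * m)) (by positivity)
      (le_of_eq (by field_simp; ring)) (fun x hx => hnet x hx) _ hlower
      (fun x => (Wᗮ.norm_starProjection_apply_le _).trans (hU' x)) u
    refine le_trans (le_of_eq ?_) hL
    ring
  -- The summand log(128m) in `hn` cancels the cardinality of the net, and the summand 1 leaves
  -- exp(-n).
  have hexp : (128 * m) ^ n * (2 * r) ≤ 2 * Real.exp (-n) := by
    have h1 : (128 * m) ^ n = Real.exp (n * Real.log (128 * m)) := by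
      rw [Real.exp_nat_mul, Real.exp_log (by positivity)]
    have h2 : (Real.log (128 * m) + 1) * n ≤ τ / (256 * m ^ 4 * g) := by
      rw [show τ / (256 * m ^ 4 * g) = (τ / g) / (256 * m ^ 4) by field_simp,
        le_div_iff₀ (by positivity)]
      linarith
    rw [h1, hr, mul_left_comm, ← Real.exp_add]
    gcongr
    linarith
  calc _ ≤ P (⋃ c ∈ s, (up c ∪ lo c)) := measure_mono hsubset
    _ ≤ ∑ c ∈ s, P (up c ∪ lo c) := measure_biUnion_finset_le _ _
    _ ≤ ∑ _c ∈ s, ENNReal.ofReal (2 * r) := by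
        refine Finset.sum_le_sum fun c hc => (measure_union_le _ _).trans ?_
        rw [two_mul, ENNReal.ofReal_add (Real.exp_pos _).le (Real.exp_pos _).le]
        exact add_le_add (hPup c hc) (hPlo c hc)
    _ = ENNReal.ofReal (s.card * (2 * r)) := by
        rw [Finset.sum_const, nsmul_eq_mul, ENNReal.ofReal_mul (p := (s.card : ℝ)) (by positivity),
          ENNReal.ofReal_natCast]
    _ ≤ _ := ENNReal.ofReal_le_ofReal
        ((mul_le_mul_of_nonneg_right hcard (by positivity)).trans hexp)

/-! ### Consequences of a ψ₂ bound. -/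

section PsiTwo

variable {Ω : Type*} [MeasurableSpace Ω] {P : Measure Ω} {U : Ω → ℝ} {M : ℝ≥0}

theorem lintegral_exp_sq_le_of_psiTwoNorm_le (h : psiTwoNorm P U ≤ M) :
    ∫⁻ ω, ENNReal.ofReal (Real.exp (U ω ^ 2 / ((M : ℝ) + 1) ^ 2)) ∂P ≤ 2 := by
  -- The infimum need not be attained and M may be 0; passing to M + 1 gives an admissible t below
  -- it, and a scale that is at least 1.
  have h1 : psiTwoNorm P U < ((M + 1 : ℝ≥0) : ℝ≥0∞) :=
    h.trans_lt (ENNReal.coe_lt_coe.2 (lt_add_one M))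
  simp only [psiTwoNorm, iInf_lt_iff] at h1
  obtain ⟨t, ht, hle, htM⟩ := h1
  refine (lintegral_mono fun ω => ENNReal.ofReal_le_ofReal (Real.exp_le_exp.2 ?_)).trans hle
  have ht' : (0 : ℝ) < t := ht
  have htM' : (t : ℝ) ≤ M + 1 := by exact_mod_cast (ENNReal.coe_lt_coe.1 htM).le
  gcongr

theorem isStdSubGaussian_of_psiTwoNorm_le (hU : Measurable U)
    (h : psiTwoNorm P U ≤ M) (hmean : ∫ ω, U ω ∂P = 0) (hvar : Var[U; P] = 1) :
    IsStdSubGaussian (P.map U) (M + 1) := by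
  have hlin := lintegral_exp_sq_le_of_psiTwoNorm_le h
  have hmeas : Measurable fun ω => Real.exp (U ω ^ 2 / ((M : ℝ) + 1) ^ 2) := by fun_prop
  have hint : Integrable (fun ω => Real.exp (U ω ^ 2 / ((M : ℝ) + 1) ^ 2)) P := by
    rw [← lintegral_ofReal_ne_top_iff_integrable hmeas.aestronglyMeasurable
      (ae_of_all _ fun ω => (Real.exp_pos _).le)]
    exact ne_top_of_le_ne_top (by simp) hlin
  have hm : Continuous fun x : ℝ => Real.exp (x ^ 2 / ((M : ℝ) + 1) ^ 2) := by fun_prop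
  refine ⟨by simp, ?_, ?_, ?_, ?_⟩
  · rwa [integrable_map_measure hm.aestronglyMeasurable hU.aemeasurable]
  · rw [integral_map hU.aemeasurable hm.aestronglyMeasurable,
      integral_eq_lintegral_of_nonneg_ae (ae_of_all _ fun ω => (Real.exp_pos _).le)
        hmeas.aestronglyMeasurable]
    exact ENNReal.toReal_le_of_le_ofReal (by norm_num) (by simpa using hlin)
  · rwa [integral_map hU.aemeasurable (by fun_prop)]
  · rw [integral_map hU.aemeasurable (by fun_prop)]
    rwa [variance_of_integral_eq_zero hU.aemeasurable hmean] at hvar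

theorem measure_sq_gt_le_of_psiTwoNorm_le (hU : Measurable U) (h : psiTwoNorm P U ≤ M)
    {n : ℝ} (hn : 0 < n) :
    P {ω | 2 * ((M : ℝ) + 1) ^ 2 * Real.log n < U ω ^ 2} ≤ ENNReal.ofReal (2 / n ^ 2) := by
  have h1 := measure_le_of_lintegral_exp_le (P := P)
    (f := fun ω => U ω ^ 2 / ((M : ℝ) + 1) ^ 2) (s := Real.log 2) (t := 2 * Real.log n)
    (by fun_prop) (by
      rw [Real.exp_log two_pos, ENNReal.ofReal_ofNat]
      exact lintegral_exp_sq_le_of_psiTwoNorm_le h)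
  have h2 : Real.exp (Real.log 2 - 2 * Real.log n) = 2 / n ^ 2 := by
    rw [Real.exp_sub, Real.exp_log two_pos, two_mul, Real.exp_add, Real.exp_log hn, sq]
  rw [h2] at h1
  refine (measure_mono fun ω hω => ?_).trans h1
  simp only [Set.mem_ofPred_eq] at hω ⊢
  rw [le_div_iff₀ (by positivity)]
  linarith

end PsiTwo

/-! ### Square roots of covariance matrices. -/

section Sqrt

variable {d : ℕ} {Q : Matrix (Fin d) (Fin d) ℝ}

theorem isHermitian_sqrt (Q : Matrix (Fin d) (Fin d) ℝ) : (CFC.sqrt Q).IsHermitian :=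
  (Matrix.nonneg_iff_posSemidef.1 (CFC.sqrt_nonneg Q)).1

theorem Matrix.PosSemidef.sqrt_mul_sqrt (hQ : Q.PosSemidef) : CFC.sqrt Q * CFC.sqrt Q = Q :=
  CFC.sqrt_mul_sqrt_self Q hQ.nonneg

theorem Matrix.PosSemidef.norm_sq_sqrt_le (hQ : Q.PosSemidef) (x : EuclideanSpace ℝ (Fin d)) :
    ‖Matrix.toEuclideanLin (CFC.sqrt Q) x‖ ^ 2 ≤ matrixOpNorm Q * ‖x‖ ^ 2 := by
  have hS := Matrix.isSymmetric_toEuclideanLin_iff.mpr (isHermitian_sqrt Q)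
  have h1 : Matrix.toEuclideanLin (CFC.sqrt Q) (Matrix.toEuclideanLin (CFC.sqrt Q) x)
      = Matrix.toEuclideanCLM (𝕜 := ℝ) Q x := by
    conv_rhs => rw [← hQ.sqrt_mul_sqrt]
    rw [map_mul]
    rfl
  rw [← real_inner_self_eq_norm_sq, hS, h1]
  refine (real_inner_le_norm _ _).trans ?_
  have h2 := (Matrix.toEuclideanCLM (𝕜 := ℝ) Q).le_opNorm x
  have h3 := mul_le_mul_of_nonneg_left h2 (norm_nonneg x)
  rw [matrixOpNorm]
  linarith

theorem Matrix.PosSemidef.trace_gramMatrix_sqrt (hQ : Q.PosSemidef) :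
    (Matrix.toEuclideanLin (CFC.sqrt Q)).gramMatrix.trace = Q.trace := by
  have hS := isHermitian_sqrt Q
  conv_rhs => rw [← hQ.sqrt_mul_sqrt]
  rw [LinearMap.trace_gramMatrix, Matrix.trace]
  refine Finset.sum_congr rfl fun j _ => ?_
  rw [EuclideanSpace.real_norm_sq_eq, Matrix.diag_apply, Matrix.mul_apply]
  refine Finset.sum_congr rfl fun i _ => ?_
  have h1 : CFC.sqrt Q j i = CFC.sqrt Q i j := by
    conv_lhs => rw [← hS]
    simp [Matrix.conjTranspose_apply]
  rw [h1, sq, EuclideanSpace.basisFun_apply, Matrix.toLpLin_apply]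
  simp

end Sqrt

/-! ### The factor model: bad events and the norm bound. -/

namespace FactorRegression

variable {n p K : ℕ} (F : FactorRegression.{u, v} n p K)

/-- The noise matrix, with rows `E_i`. -/
def noiseMatrix (ω : F.Ω) : Matrix (Fin n) (Fin p) ℝ := Matrix.of fun i => F.Es i ω

theorem posSemidef_covE : F.covE.PosSemidef := posSemidef_covarianceMatrix F.memLp_E

theorem posSemidef_covZ : F.covZ.PosSemidef := posSemidef_covarianceMatrix F.memLp_Z

theorem identDistrib_Es (i : Fin n) : IdentDistrib (F.Es i) F.E F.P F.P₀ :=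
  (F.identDistrib_sample i).comp (u := fun q : (Fin K → ℝ) × (Fin p → ℝ) × ℝ => q.2.1)
    (by fun_prop)

theorem identDistrib_εs (i : Fin n) : IdentDistrib (F.εs i) F.ε F.P F.P₀ :=
  (F.identDistrib_sample i).comp (u := fun q : (Fin K → ℝ) × (Fin p → ℝ) × ℝ => q.2.2)
    (by fun_prop)

theorem iIndepFun_Es : iIndepFun F.Es F.P :=
  F.iIndep_sample.comp (fun _ q => q.2.1) fun _ => by fun_prop

theorem measure_not_isWellSpread_noiseMatrix_le {M : ℝ≥0} (hF : F.SubGaussian M)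
    (W : Submodule ℝ (EuclideanSpace ℝ (Fin p))) (hpos : 0 < matrixOpNorm F.covE)
    (hW : 2 * (Module.finrank ℝ W * matrixOpNorm F.covE) ≤ F.covE.trace)
    (hn : 256 * ((M : ℝ) + 1) ^ 4 * (Real.log (128 * (M + 1)) + 1) * n
      ≤ F.covE.trace / matrixOpNorm F.covE) :
    F.P {ω | ¬ IsWellSpread W (√F.covE.trace / 8) (4 * ((M : ℝ) + 1) * √F.covE.trace)
      (F.noiseMatrix ω)} ≤ ENNReal.ofReal (2 * Real.exp (-n)) := by
  obtain ⟨Et, hEt, hEEt, hind, hprop⟩ := hF.1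
  set S := CFC.sqrt F.covE with hS
  -- The variable Ẽ is given only on the population space, so independent copies of it are built on
  -- the n-fold product and the noise rows are compared with them in law.
  set ν : Measure (Fin n → F.Ω₀) := Measure.pi fun _ => F.P₀ with hν
  have hEtj : ∀ j, Measurable fun ω => Et ω j := fun j => (measurable_pi_apply j).comp hEt
  have heval : ∀ i : Fin n, MeasurePreserving (Function.eval i) ν F.P₀ := fun i =>
    measurePreserving_eval _ i
  set ξ : Fin n × Fin p → (Fin n → F.Ω₀) → ℝ := fun q ω => Et (ω q.1) q.2 with hξdef
  have hmeas : ∀ q, Measurable (ξ q) := fun q => (hEtj q.2).comp (measurable_pi_apply q.1)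
  have hξ : iIndepFun ξ ν := by
    refine iIndepFun_uncurry' (X := fun i j (ω : Fin n → F.Ω₀) => Et (ω i) j)
      (fun i j => hmeas (i, j)) ?_ fun i => ?_
    · exact iIndepFun_pi (X := fun _ : Fin n => Et) fun _ => hEt.aemeasurable
    · rw [iIndepFun_iff_map_fun_eq_pi_map fun j => (hmeas (i, j)).aemeasurable]
      rw [iIndepFun_iff_map_fun_eq_pi_map fun j => (hEtj j).aemeasurable, ← (heval i).map_eq,
        Measure.map_map (by fun_prop) (heval i).measurable] at hind
      refine hind.trans ?_
      congr 1
      ext1 j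
      rw [Measure.map_map (hEtj j) (heval i).measurable]
      rfl
  have hsub : ∀ q, IsStdSubGaussian (ν.map (ξ q)) ((M : ℝ) + 1) := fun q => by
    have h1 : ν.map (ξ q) = F.P₀.map fun ω => Et ω q.2 := by
      rw [← (heval q.1).map_eq, Measure.map_map (hEtj q.2) (heval q.1).measurable]
      rfl
    rw [h1]
    exact isStdSubGaussian_of_psiTwoNorm_le (hEtj q.2) (hprop q.2).2.2 (hprop q.2).1
      (hprop q.2).2.1
  have hSmeas : Measurable fun ω => S.mulVec (Et ω) :=
    (Continuous.matrix_mulVec continuous_const continuous_id).measurable.comp hEt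
  have hident : IdentDistrib (fun ω i => F.Es i ω)
      (fun (ω : Fin n → F.Ω₀) i => S.mulVec (Et (ω i))) F.P ν := by
    refine IdentDistrib.pi (fun i => (F.identDistrib_Es i).trans ?_) F.iIndepFun_Es ?_
    · refine ⟨F.measurable_E.aemeasurable, (hSmeas.comp (heval i).measurable).aemeasurable, ?_⟩
      rw [Measure.map_congr hEEt, ← (heval i).map_eq, Measure.map_map hSmeas (heval i).measurable]
      rfl
    · exact iIndepFun_pi (X := fun _ : Fin n => fun ω => S.mulVec (Et ω))
        fun _ => hSmeas.aemeasurable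
  have hset := (isClosed_isWellSpread (n := n) W (√F.covE.trace / 8)
    (4 * ((M : ℝ) + 1) * √F.covE.trace)).measurableSet.compl
  refine (hident.measure_mem_eq hset).trans_le ?_
  exact measure_not_isWellSpread_le hξ (fun q => (hmeas q).aemeasurable) (by simp) hsub
    (isHermitian_sqrt _) hpos F.posSemidef_covE.norm_sq_sqrt_le W
    F.posSemidef_covE.trace_gramMatrix_sqrt.symm hW hn

theorem measure_exists_εs_sq_gt_le {M : ℝ≥0} (hF : F.SubGaussian M) (hn : 0 < n) :
    F.P {ω | ∃ i, 2 * ((M : ℝ) + 1) ^ 2 * Real.log n * F.varε < F.εs i ω ^ 2}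
      ≤ ENNReal.ofReal (2 / n) := by
  obtain ⟨εt, hεt, hεε, -, hψ⟩ := hF.2.2
  have hn' : (0 : ℝ) < n := by exact_mod_cast hn
  have h1 : ∀ i, F.P {ω | 2 * ((M : ℝ) + 1) ^ 2 * Real.log n * F.varε < F.εs i ω ^ 2}
      ≤ ENNReal.ofReal (2 / (n : ℝ) ^ 2) := fun i => by
    have hset : MeasurableSet {x : ℝ | 2 * ((M : ℝ) + 1) ^ 2 * Real.log n * F.varε < x ^ 2} :=
      measurableSet_lt measurable_const (by fun_prop)
    refine ((F.identDistrib_εs i).measure_mem_eq hset).trans_le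
      (le_trans (measure_mono_ae ?_) (measure_sq_gt_le_of_psiTwoNorm_le hεt hψ hn'))
    filter_upwards [hεε] with ω hω hmem
    have hv : 0 ≤ F.varε := variance_nonneg _ _
    have hmem' : 2 * ((M : ℝ) + 1) ^ 2 * Real.log n * F.varε < F.ε ω ^ 2 := hmem
    rw [hω, mul_pow, Real.sq_sqrt hv, mul_comm F.varε] at hmem'
    -- The inequality is strict, so this is valid for zero variance too, where the premise is
    -- impossible.
    exact lt_of_mul_lt_mul_right hmem' hv
  rw [Set.ofPred_exists]
  calc _ ≤ ∑ i, F.P {ω | 2 * ((M : ℝ) + 1) ^ 2 * Real.log n * F.varε < F.εs i ω ^ 2} :=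
        measure_iUnion_fintype_le _ _
    _ ≤ ∑ _i : Fin n, ENNReal.ofReal (2 / (n : ℝ) ^ 2) := Finset.sum_le_sum fun i _ => h1 i
    _ = ENNReal.ofReal (2 / n) := by
        rw [Finset.sum_const, Finset.card_univ, Fintype.card_fin, nsmul_eq_mul,
          ← ENNReal.ofReal_natCast, ← ENNReal.ofReal_mul hn'.le]
        congr 1
        field_simp

theorem toEuclideanLin_X_transpose (ω : F.Ω) (u : EuclideanSpace ℝ (Fin n)) :
    Matrix.toEuclideanLin (F.X ω).transpose u
      = Matrix.toEuclideanLin F.A (WithLp.toLp 2 fun k => ∑ i, u i * F.Zs i ω k)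
        + Matrix.toEuclideanLin (F.noiseMatrix ω).transpose u := by
  ext j
  simp only [Matrix.toLpLin_apply, Matrix.mulVec, dotProduct, Matrix.transpose_apply, X,
    noiseMatrix, Matrix.of_apply, PiLp.add_apply, Pi.add_apply, add_mul, Finset.sum_add_distrib,
    Finset.mul_sum, Finset.sum_mul]
  congr 1
  rw [Finset.sum_comm]
  exact Finset.sum_congr rfl fun k _ => Finset.sum_congr rfl fun i _ => by ring

theorem y_sub_toEuclideanLin_X (ω : F.Ω) {a : EuclideanSpace ℝ (Fin p)}
    (ha : F.A.transpose.mulVec a = F.β) :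
    F.y ω - Matrix.toEuclideanLin (F.X ω) a
      = WithLp.toLp 2 (fun i => F.εs i ω) - Matrix.toEuclideanLin (F.noiseMatrix ω) a := by
  ext i
  have h1 : F.A.mulVec (F.Zs i ω) ⬝ᵥ a.ofLp = F.Zs i ω ⬝ᵥ F.β := by
    rw [← ha, Matrix.dotProduct_mulVec, Matrix.vecMul_transpose]
  have h2 : (Matrix.toEuclideanLin (F.X ω) a) i
      = F.A.mulVec (F.Zs i ω) ⬝ᵥ a.ofLp + F.Es i ω ⬝ᵥ a.ofLp := by
    rw [← add_dotProduct]; rfl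
  have h3 : (Matrix.toEuclideanLin (F.noiseMatrix ω) a) i = F.Es i ω ⬝ᵥ a.ofLp := rfl
  rw [PiLp.sub_apply, PiLp.sub_apply, h2, h3, h1]
  simp only [y]
  ring

/-- The bound on the estimator for well-spread noise and bounded errors. -/
theorem norm_αHat_sq_le (hK : 1 ≤ K) (hF : F.FullRank) {m τ w : ℝ} (hm : 1 ≤ m) (hτ : 0 < τ)
    {ω : F.Ω} (hspread : IsWellSpread (LinearMap.range (Matrix.toEuclideanLin F.A)) (√τ / 8)
      (4 * m * √τ) (F.noiseMatrix ω)) (hε : ∀ i, F.εs i ω ^ 2 ≤ w) :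
    ‖F.αHat ω‖ ^ 2 ≤ 2178 * m ^ 2 * (F.signal / F.signalEigenvalue) + 128 * (n * w / τ) := by
  obtain ⟨a, haβ, hanorm⟩ := exists_transpose_mulVec_eq hK F.posSemidef_covZ hF.1 hF.2 F.β
  have hs : 0 < √τ / 8 := by positivity
  set W := LinearMap.range (Matrix.toEuclideanLin F.A)
  have hX : ∀ u, √τ / 8 * ‖u‖ ≤ ‖Matrix.toEuclideanLin (F.X ω).transpose u‖ := fun u => by
    refine (hspread.2 u).trans (le_trans (le_of_eq ?_)
      (Wᗮ.norm_starProjection_apply_le (Matrix.toEuclideanLin (F.X ω).transpose u)))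
    have h0 : ∀ v, Wᗮ.starProjection (Matrix.toEuclideanLin F.A v) = 0 := fun v =>
      Wᗮ.starProjection_apply_eq_zero_iff.2 (by
        rw [Submodule.orthogonal_orthogonal]
        exact LinearMap.mem_range_self (Matrix.toEuclideanLin F.A) v)
    rw [F.toEuclideanLin_X_transpose, map_add, h0, zero_add]
  have h1 := norm_minNormLeastSquares_le hs hX (F.y ω) a
  rw [F.y_sub_toEuclideanLin_X ω haβ] at h1
  set ε : EuclideanSpace ℝ (Fin n) := WithLp.toLp 2 fun i => F.εs i ω with hεdef
  have h2 := norm_toEuclideanLin_le_of_transpose (by positivity) hspread.1 a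
  have h3 : ‖ε‖ ^ 2 ≤ n * w := by
    rw [EuclideanSpace.real_norm_sq_eq]
    refine (Finset.sum_le_sum fun i _ => hε i).trans_eq ?_
    simp
  -- 33m bounds 1 + 32m, with 32m = 4m√τ / (√τ/8). Squaring a sum of two terms then gives 2·33² =
  -- 2178 and 2·64 = 128.
  have h4 : ‖F.αHat ω‖ ≤ 33 * m * ‖a‖ + ‖ε‖ / (√τ / 8) := by
    refine h1.trans ?_
    have h5 := (norm_sub_le ε (Matrix.toEuclideanLin (F.noiseMatrix ω) a)).trans
      (add_le_add_right h2 _)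
    have h6 : (‖ε‖ + 4 * m * √τ * ‖a‖) / (√τ / 8) = ‖ε‖ / (√τ / 8) + 32 * m * ‖a‖ := by
      field_simp; ring
    have h7 := div_le_div_of_nonneg_right h5 hs.le
    have h8 : ‖a‖ ≤ m * ‖a‖ := le_mul_of_one_le_left (norm_nonneg a) hm
    linarith
  have h5 : (‖ε‖ / (√τ / 8)) ^ 2 = 64 * (‖ε‖ ^ 2 / τ) := by
    rw [div_pow, div_pow, Real.sq_sqrt hτ.le]; field_simp; norm_num
  have h6 : ‖ε‖ ^ 2 / τ ≤ n * w / τ := by gcongr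
  have h7 : m ^ 2 * ‖a‖ ^ 2 ≤ m ^ 2 * (F.signal / F.signalEigenvalue) := by
    gcongr
    exact hanorm
  have h8 := pow_le_pow_left₀ (norm_nonneg _) h4 2
  have h9 := sq_nonneg (33 * m * ‖a‖ - ‖ε‖ / (√τ / 8))
  nlinarith

/-- The probability that the norm bound fails is at most `4 / n`. -/
theorem norm_bound_of_conditions {M : ℝ≥0} (hF : F.Conditions M
      (256 * ((M : ℝ) + 1) ^ 4 * (Real.log (128 * (M + 1)) + 1))) :
    0 < n ∧ 0 < matrixOpNorm F.covE ∧ effectiveRank F.covE = F.covE.trace / matrixOpNorm F.covE ∧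
      0 < effectiveRank F.covE ∧
      1 - 5 / n < F.P.real {ω | ‖F.αHat ω‖ ^ 2 ≤ 2178 * ((M : ℝ) + 1) ^ 2 *
        (F.signal / F.signalEigenvalue + F.varε * (n * Real.log n / F.covE.trace))} := by
  set m : ℝ := (M : ℝ) + 1 with hm
  have hm1 : 1 ≤ m := by simp [hm]
  set C := 256 * m ^ 4 * (Real.log (128 * m) + 1) with hC
  have hC256 : 256 ≤ C := by
    have h1 : 1 ≤ m ^ 4 := one_le_pow₀ hm1
    have h2 : 0 ≤ Real.log (128 * m) := Real.log_nonneg (by linarith)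
    nlinarith [mul_nonneg (sub_nonneg.2 h1) h2]
  have hK : (1 : ℝ) ≤ K := by exact_mod_cast hF.one_le_K
  have hKn : (K : ℝ) < n := lt_of_le_of_lt (by nlinarith) hF.n_large
  have hn : (0 : ℝ) < n := by linarith
  have hr := hF.effectiveRank_large
  -- For zero covariance the effective rank is 1 by convention, which C n < 1 excludes.
  have hne : F.covE ≠ 0 := fun h0 => by
    rw [effectiveRank, if_pos h0] at hr
    nlinarith
  have hreq : effectiveRank F.covE = F.covE.trace / matrixOpNorm F.covE := by
    rw [effectiveRank, if_neg hne]
  have hop : 0 < matrixOpNorm F.covE := by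
    rw [matrixOpNorm, norm_pos_iff]
    exact fun h => hne (by simpa using h)
  have hrpos : 0 < effectiveRank F.covE := lt_trans (by positivity) hr
  have htr : 0 < F.covE.trace := by
    rw [hreq] at hrpos
    exact (div_pos_iff_of_pos_right hop).1 hrpos
  refine ⟨by exact_mod_cast hn, hop, hreq, hrpos, ?_⟩
  rw [hreq] at hr
  set W := LinearMap.range (Matrix.toEuclideanLin F.A) with hW
  have hWK : (Module.finrank ℝ W : ℝ) ≤ K := by
    have := LinearMap.finrank_range_le (Matrix.toEuclideanLin F.A)
    rw [finrank_euclideanSpace_fin] at this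
    exact_mod_cast this
  have hWtr : 2 * (Module.finrank ℝ W * matrixOpNorm F.covE) ≤ F.covE.trace := by
    rw [lt_div_iff₀ hop] at hr
    have : 2 * (Module.finrank ℝ W : ℝ) ≤ C * n := by nlinarith
    nlinarith
  have hbad1 := F.measure_not_isWellSpread_noiseMatrix_le hF.subGaussian W hop hWtr hr.le
  have hbad2 := F.measure_exists_εs_sq_gt_le hF.subGaussian (by exact_mod_cast hn)
  set good := {ω | ‖F.αHat ω‖ ^ 2 ≤ 2178 * m ^ 2 *
        (F.signal / F.signalEigenvalue + F.varε * (n * Real.log n / F.covE.trace))}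
  set bad1 := {ω | ¬ IsWellSpread W (√F.covE.trace / 8) (4 * m * √F.covE.trace) (F.noiseMatrix ω)}
  set bad2 := {ω | ∃ i, 2 * m ^ 2 * Real.log n * F.varε < F.εs i ω ^ 2}
  -- Only monotonicity and subadditivity of the measure enter, so measurability of the estimator is
  -- not needed.
  have hcover : Set.univ ⊆ good ∪ (bad1 ∪ bad2) := by
    intro ω _
    by_contra hcon
    simp only [Set.mem_union, not_or] at hcon
    obtain ⟨hg, h1, h2⟩ := hcon
    refine hg ?_
    have h1' : IsWellSpread W (√F.covE.trace / 8) (4 * m * √F.covE.trace) (F.noiseMatrix ω) :=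
      not_not.1 h1
    have h2' : ∀ i, F.εs i ω ^ 2 ≤ 2 * m ^ 2 * Real.log n * F.varε := fun i =>
      not_lt.1 fun h => h2 ⟨i, h⟩
    refine (F.norm_αHat_sq_le hF.one_le_K hF.fullRank hm1 htr h1' h2').trans ?_
    have hv : 0 ≤ F.varε := variance_nonneg _ _
    have hlog : 0 ≤ Real.log n := Real.log_nonneg (by linarith)
    have h3 : 0 ≤ m ^ 2 * (F.varε * (n * Real.log n / F.covE.trace)) := by positivity
    have h4 : (n : ℝ) * (2 * m ^ 2 * Real.log n * F.varε) / F.covE.trace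
        = 2 * (m ^ 2 * (F.varε * (n * Real.log n / F.covE.trace))) := by ring
    rw [h4]
    linarith
  have hexp : 2 * Real.exp (-(n : ℝ)) ≤ 2 / n := by
    rw [Real.exp_neg, ← div_eq_mul_inv]
    gcongr
    linarith [Real.add_one_le_exp (n : ℝ)]
  have h1 : F.P.real bad1 ≤ 2 / n := by
    rw [Measure.real]
    exact ENNReal.toReal_le_of_le_ofReal (by positivity)
      (hbad1.trans (ENNReal.ofReal_le_ofReal hexp))
  have h2 : F.P.real bad2 ≤ 2 / n := by
    rw [Measure.real]
    exact ENNReal.toReal_le_of_le_ofReal (by positivity) hbad2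
  have h3 : (1 : ℝ) ≤ F.P.real good + (F.P.real bad1 + F.P.real bad2) := by
    rw [← probReal_univ (μ := F.P)]
    refine (measureReal_mono hcover).trans ((measureReal_union_le _ _).trans ?_)
    gcongr
    exact measureReal_union_le _ _
  -- The two bad events take 4/n; the spare 1/n makes the inequality strict.
  have h4 : (5 : ℝ) / n = 2 / n + 2 / n + 1 / n := by ring
  have h5 : (0 : ℝ) < 1 / n := by positivity
  linarith

end FactorRegression

/-! ### The three conclusions. -/

theorem mainTheorem6 (M : ℝ≥0) :
    ∃ C c : ℝ, 0 < C ∧ 0 < c ∧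
      -- the norm bound, with an absolute constant
      (∃ C' : ℝ, 0 < C' ∧ ∀ (n p K : ℕ) (F : FactorRegression.{u, v} n p K), F.Conditions M C →
        1 - c / n < F.P.real {ω | ‖F.αHat ω‖ ^ 2 ≤ C' * (F.signal / F.signalEigenvalue
          + F.varε * (n * Real.log n / F.covE.trace))}) ∧
      -- the same bound in terms of the effective rank, if the norm of the noise covariance is
      -- bounded below
      (∀ κ : ℝ, 0 < κ → ∃ C' : ℝ, 0 < C' ∧
        ∀ (n p K : ℕ) (F : FactorRegression.{u, v} n p K), F.Conditions M C →
        κ ≤ matrixOpNorm F.covE →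
        1 - c / n < F.P.real {ω | ‖F.αHat ω‖ ^ 2 ≤ C' * (F.signal / F.signalEigenvalue
          + F.varε * (n * Real.log n / effectiveRank F.covE))}) ∧
      -- hence the norm of the estimator vanishes in probability
      (∀ (n p K : ℕ → ℕ) (F : ∀ m, FactorRegression.{u, v} (n m) (p m) (K m)),
        (∀ m, (F m).Conditions M C) →
        Tendsto n atTop atTop →
        Tendsto (fun m => (F m).signal / (F m).signalEigenvalue) atTop (𝓝 0) →
        Tendsto (fun m => (F m).varε * (n m * Real.log (n m) / (F m).covE.trace))
          atTop (𝓝 0) →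
        ∀ δ : ℝ, 0 < δ →
          Tendsto (fun m => (F m).P.real {ω | ‖(F m).αHat ω‖ < δ}) atTop (𝓝 1)) := by
  have hlog : 0 ≤ Real.log (128 * ((M : ℝ) + 1)) :=
    Real.log_nonneg (by linarith [M.coe_nonneg])
  refine ⟨256 * ((M : ℝ) + 1) ^ 4 * (Real.log (128 * (M + 1)) + 1), 5, by positivity, by norm_num,
    ⟨2178 * ((M : ℝ) + 1) ^ 2, by positivity, fun n p K F hF =>
      (F.norm_bound_of_conditions hF).2.2.2.2⟩, fun κ hκ => ?_, ?_⟩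
  · refine ⟨2178 * ((M : ℝ) + 1) ^ 2 * max 1 κ⁻¹, by positivity, fun n p K F hF hop => ?_⟩
    obtain ⟨hn, hpos, hr, hr0, hbound⟩ := F.norm_bound_of_conditions hF
    refine hbound.trans_le (measureReal_mono fun ω hω => ?_)
    have hω' : ‖F.αHat ω‖ ^ 2 ≤ 2178 * ((M : ℝ) + 1) ^ 2 *
      (F.signal / F.signalEigenvalue + F.varε * (n * Real.log n / F.covE.trace)) := hω
    refine hω'.trans ?_
    rw [mul_assoc (2178 * ((M : ℝ) + 1) ^ 2)]
    refine mul_le_mul_of_nonneg_left ?_ (by positivity)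
    have hsig : 0 ≤ F.signal / F.signalEigenvalue := by
      obtain ⟨a, -, ha⟩ := exists_transpose_mulVec_eq hF.one_le_K F.posSemidef_covZ
        hF.fullRank.1 hF.fullRank.2 F.β
      exact (sq_nonneg _).trans ha
    have hv : 0 ≤ F.varε := variance_nonneg _ _
    have hlogn : 0 ≤ Real.log n := Real.log_natCast_nonneg n
    have htr : F.covE.trace = effectiveRank F.covE * matrixOpNorm F.covE := by
      rw [hr, div_mul_cancel₀ _ hpos.ne']
    have h1 : F.varε * (n * Real.log n / F.covE.trace)
        ≤ κ⁻¹ * (F.varε * (n * Real.log n / effectiveRank F.covE)) := by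
      have h2 : κ⁻¹ * (F.varε * (n * Real.log n / effectiveRank F.covE))
          = F.varε * (n * Real.log n / (effectiveRank F.covE * κ)) := by
        field_simp
      rw [h2, htr]
      gcongr
    have h3 : 0 ≤ F.varε * (n * Real.log n / effectiveRank F.covE) := by positivity
    have h4 := mul_le_mul_of_nonneg_right (le_max_left 1 κ⁻¹) hsig
    have h5 := mul_le_mul_of_nonneg_right (le_max_right 1 κ⁻¹) h3
    linarith
  · intro n p K F hF hn hsig hnoise δ hδ
    have hlim : Tendsto (fun m => 2178 * ((M : ℝ) + 1) ^ 2 *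
        ((F m).signal / (F m).signalEigenvalue
          + (F m).varε * (n m * Real.log (n m) / (F m).covE.trace))) atTop (𝓝 0) := by
      simpa using (hsig.add hnoise).const_mul (2178 * ((M : ℝ) + 1) ^ 2)
    have hlow : Tendsto (fun m => 1 - 5 / (n m : ℝ)) atTop (𝓝 1) := by
      simpa using ((tendsto_const_nhds (x := (5 : ℝ))).div_atTop
        (tendsto_natCast_atTop_atTop.comp hn)).const_sub 1
    have hδ2 : (0 : ℝ) < δ ^ 2 := by positivity
    refine tendsto_of_tendsto_of_tendsto_of_le_of_le' hlow tendsto_const_nhds ?_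
      (Eventually.of_forall fun m => measureReal_le_one)
    filter_upwards [hlim.eventually_lt_const hδ2] with m hm
    refine ((F m).norm_bound_of_conditions (hF m)).2.2.2.2.le.trans
      (measureReal_mono fun ω hω => ?_)
    have hω' : ‖(F m).αHat ω‖ ^ 2 ≤ 2178 * ((M : ℝ) + 1) ^ 2 *
      ((F m).signal / (F m).signalEigenvalue
        + (F m).varε * (n m * Real.log (n m) / (F m).covE.trace)) := hω
    exact lt_of_pow_lt_pow_left₀ 2 hδ.le (hω'.trans_lt hm)
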